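/- Let $n\ge 0$, $d\ge 1$ and $0<\rho\le R$, $M,U>0$. An instance is a pair $(f,C)$ with $f:\mathbb R^{n}\times\mathbb R^d\to\mathbb R$ convex and $C\subseteq[-R,R]^{n+d}$ closed and convex; the problem is to minimize $f$ over the feasible set $C\cap(\mathbb Z^n\times\mathbb R^d)$. A feasible point $z$ is an $\epsilon$-approximate solution if $f(z)\le f(z')+\epsilon$ for all feasible $z'$. Let $\mathcal I$ be the class of instances such that - an optimal solution exists, and for every optimal solution $(x^\star,y^\star)$ there is $\bar y\in\mathbb R^d$ such that the $(n+d)$-dimensional $\ell_\infty$ ball of radius $\rho$ centred at $(x^\star,\bar y)$ is contained in $C$; - $f$ is $M$-Lipschitz with respect to $\|\cdot\|_\infty$ on $\{x\}\times[-R,R]^d$ for every $x\in\mathbb Z^n\cap[-R,R]^n$; - on $[-R,R]^{n+d}$ the values of $f$ lie in $[-U,U]$ and any two of them differ by at most $2MR$ (automatic if $U\le MR$, or if $f$ is $M$-Lipschitz with respect to $\|\cdot\|_\infty$ on the whole box). A first-order chart $\mathcal G$ assigns to every $z\in[-R,R]^{n+d}$ and every instance $(f,C)$ a vector $g^{\rm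 sep}_z(f,C)$, which is $0$ if $z\in C$ and otherwise has Euclidean norm $1$ and satisfies $\langle g^{\rm sep}_z,z'\rangle<\langle g^{\rm sep}_z,z\rangle$ for all $z'\in C$; the value $g^{\rm val}_z(f,C)=f(z)$; and a subgradient $g^{\rm sub}_z(f,C)\in\partial f(z)$. A query picks $z\in[-R,R]^{n+d}$, one of the three maps, and a permissible binary function of its value. The permissible functions are either (bit queries, $\mathcal H^{\rm bit}$) the sign bit or any one bit of the binary representation of a chosen coordinate, or (inner product threshold queries, $\mathcal H^{\rm dir}$) the answer to "is the inner product with $u$ at least $c$?" for a chosen vector (for values, number) $u$ and real $c$. A query strategy chooses each query from the previous queries and answers. There is an absolute constant $K$ such that for all such $n,d,R,\rho,M,U$, every $\epsilon>0$ with $\epsilon\le M$, $\epsilon\le U$ and $MR\ge 2\min\{\rho,1\}\,\epsilon$, and each of $\mathcal H=\mathcal H^{\rm bit}$ and $\mathcal H=\mathcal H^{\rm dir}$, there is a query strategy, not depending on the chart, that for every first-order chart $\mathcal G$ and every instance of $\mathcal I$ reports an $\epsilon$-approximate solution, computed from the queries and answers alone, after at most $$K\cdot 2^n d\,(n+d)\log\!\left(\frac{MR}{\min\{\rho,1\}\,\epsilon}\right)\cdot\left((n+d)\log\!\left(\frac{(n+d)MR}{\min\{\rho,1\}\,\epsilon}\right)+\log\frac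 U\epsilon\right)$$ queries. -/

import Mathlib

/-!
Mixed-integer convex optimization with binary oracles that act on first-order information.
-/

noncomputable section

namespace MixedInteger

/-- Points `(x, y)` of `ℝⁿ × ℝᵈ`. The coordinates `Sum.inl i` are the integer variables, the
coordinates `Sum.inr j` the continuous ones; `u ⬝ᵥ v` is the standard inner product. -/
abbrev Vec (n d : ℕ) : Type := Fin n ⊕ Fin d → ℝ

/-- The closed `ℓ∞` ball of radius `r` around `c`. -/
def supBall {n d : ℕ} (c : Vec n d) (r : ℝ) : Set (Vec n d) :=
  {z | ∀ i, |z i - c i| ≤ r}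

/-- The box `[-R, R]ⁿ⁺ᵈ`. -/
def box (n d : ℕ) (R : ℝ) : Set (Vec n d) :=
  {z | ∀ i, |z i| ≤ R}

/-- The mixed-integer lattice `ℤⁿ × ℝᵈ`. -/
def integerPoints (n d : ℕ) : Set (Vec n d) :=
  {z | ∀ i : Fin n, ∃ a : ℤ, z (Sum.inl i) = a}

/-- `z` and `w` lie in the same fiber `{x} × ℝᵈ`. -/
def SameFiber {n d : ℕ} (z w : Vec n d) : Prop :=
  ∀ i : Fin n, z (Sum.inl i) = w (Sum.inl i)

/-- An instance `inf {f(x, y) : (x, y) ∈ C ∩ (ℤⁿ × ℝᵈ)}` with `f` convex and real valued, and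
`C` closed and convex. -/
structure Inst (n d : ℕ) where
  /-- the objective function -/
  f : Vec n d → ℝ
  /-- the constraint set -/
  C : Set (Vec n d)
  convex_f : ConvexOn ℝ Set.univ f
  convex_C : Convex ℝ C
  closed_C : IsClosed C

namespace Inst

variable {n d : ℕ}

/-- The feasible solutions `C ∩ (ℤⁿ × ℝᵈ)`. -/
def feasible (I : Inst n d) : Set (Vec n d) :=
  I.C ∩ integerPoints n d

/-- `z` is an `ε`-approximate solution. -/
def IsApproxSolution (I : Inst n d) (ε : ℝ) (z : Vec n d) : Prop :=
  z ∈ I.feasible ∧ ∀ w ∈ I.feasible, I.f z ≤ I.f w + ε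

/-- `z` is an optimal solution. -/
def IsOptimal (I : Inst n d) (z : Vec n d) : Prop :=
  z ∈ I.feasible ∧ ∀ w ∈ I.feasible, I.f z ≤ I.f w

end Inst

/-- The class `𝓘(n, d, R, ρ, M)`: the constraint set lies in the box `[-R, R]ⁿ⁺ᵈ`; the fiber of
each optimal solution contains a `d`-dimensional `ℓ∞` ball of radius `ρ` that lies in `C`; and `f`
is `M`-Lipschitz for the `ℓ∞` norm on each integer fiber of the box. -/
def instances (n d : ℕ) (R ρ M : ℝ) : Set (Inst n d) :=
  {I | I.C ⊆ box n d R ∧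
    (∀ z, I.IsOptimal z → ∃ c, SameFiber c z ∧ ∀ w ∈ supBall c ρ, SameFiber w z → w ∈ I.C) ∧
    (∀ z ∈ box n d R, ∀ w ∈ box n d R, z ∈ integerPoints n d → SameFiber z w →
      ∀ δ : ℝ, w ∈ supBall z δ → |I.f z - I.f w| ≤ M * δ)}

/-- The subclass of `𝓘(n, d, R, ρ, M)` of the instances that have an optimal solution, such that
the fiber of each optimal solution contains the centre of an `(n + d)`-dimensional `ℓ∞` ball of
radius `ρ` inside `C`, the objective function takes values in `[-U, U]` on the box, and its values
there differ by at most `2 * M * R`. -/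
def deepInstances (n d : ℕ) (R ρ M U : ℝ) : Set (Inst n d) :=
  {I | I ∈ instances n d R ρ M ∧
    (∃ z, I.IsOptimal z) ∧
    (∀ z, I.IsOptimal z → ∃ c, SameFiber c z ∧ supBall c ρ ⊆ I.C) ∧
    (∀ z ∈ box n d R, I.f z ∈ Set.Icc (-U) U) ∧
    (∀ z ∈ box n d R, ∀ w ∈ box n d R, I.f z - I.f w ≤ 2 * M * R)}

/-- A first-order chart on the family `𝓘`: for every point `z` of the box, a separating hyperplane
map (zero if `z ∈ C`, otherwise a normal vector of Euclidean norm one that strictly separates `z`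
from `C`), a value map and a subgradient map. Nothing is required outside `𝓘`, so a chart on a
larger family gives a chart on `𝓘`. -/
structure FirstOrderChart {n d : ℕ} (R : ℝ) (𝓘 : Set (Inst n d)) where
  sep : box n d R → Inst n d → Vec n d
  val : box n d R → Inst n d → ℝ
  sub : box n d R → Inst n d → Vec n d
  sep_of_mem : ∀ z, ∀ I ∈ 𝓘, z.1 ∈ I.C → sep z I = 0
  sep_of_notMem : ∀ z, ∀ I ∈ 𝓘, z.1 ∉ I.C →
    sep z I ⬝ᵥ sep z I = 1 ∧ ∀ w ∈ I.C, sep z I ⬝ᵥ w < sep z I ⬝ᵥ z.1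
  val_eq : ∀ z, ∀ I ∈ 𝓘, val z I = I.f z.1
  sub_mem : ∀ z, ∀ I ∈ 𝓘, ∀ w, I.f z.1 + sub z I ⬝ᵥ (w - z.1) ≤ I.f w

/-- A collection of permissible binary queries: functions that may be applied to separating
hyperplanes, to function values and to subgradients. -/
structure PermissibleQueries (n d : ℕ) where
  sep : Set (Vec n d → Bool)
  val : Set (ℝ → Bool)
  sub : Set (Vec n d → Bool)

/-- The digit of weight `2 ^ j` in the binary representation of `|t|`. -/
def binaryDigit (j : ℤ) (t : ℝ) : Bool :=
  decide (⌊|t| / (2 : ℝ) ^ j⌋ % 2 = 1)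

/-- The sign bit of `t`. -/
def signBit (t : ℝ) : Bool :=
  decide (t < 0)

/-- The maps that return a bit of the binary representation of a real number. -/
def bitFunctions : Set (ℝ → Bool) :=
  {h | h = signBit ∨ ∃ j : ℤ, h = binaryDigit j}

/-- Bit queries: a desired bit of a desired coordinate. -/
def bitQueries (n d : ℕ) : PermissibleQueries n d where
  sep := {h | ∃ i, ∃ b ∈ bitFunctions, h = fun g => b (g i)}
  val := bitFunctions
  sub := {h | ∃ i, ∃ b ∈ bitFunctions, h = fun g => b (g i)}

/-- Inner product threshold queries: is the inner product with `u` at least `c`? -/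
def dirQueries (n d : ℕ) : PermissibleQueries n d where
  sep := {h | ∃ (u : Vec n d) (c : ℝ), h = fun g => decide (c ≤ u ⬝ᵥ g)}
  val := {h | ∃ u c : ℝ, h = fun t => decide (c ≤ u * t)}
  sub := {h | ∃ (u : Vec n d) (c : ℝ), h = fun g => decide (c ≤ u ⬝ᵥ g)}

/-- The queries of an oracle that uses first-order information: a point of the box together with
a permissible query. -/
inductive Query {n d : ℕ} (R : ℝ) (H : PermissibleQueries n d) : Type
  | sep (z : box n d R) (h : H.sep) : Query R H
  | val (z : box n d R) (h : H.val) : Query R H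
  | sub (z : box n d R) (h : H.sub) : Query R H

/-- The response to a query on the instance `I`, for the chart `G`. -/
def Query.answer {n d : ℕ} {R : ℝ} {H : PermissibleQueries n d} {𝓘 : Set (Inst n d)}
    (G : FirstOrderChart R 𝓘) (I : Inst n d) : Query R H → Bool
  | .sep z h => h.1 (G.sep z I)
  | .val z h => h.1 (G.val z I)
  | .sub z h => h.1 (G.sub z I)

/-- A query strategy chooses the next query from the queries and responses so far. -/
abbrev Strategy {n d : ℕ} (R : ℝ) (H : PermissibleQueries n d) : Type :=
  List (Query R H × Bool) → Query R H

/-- The first `k` query-response pairs of the strategy `D` on the instance `I`. -/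
def transcript {n d : ℕ} {R : ℝ} {H : PermissibleQueries n d} {𝓘 : Set (Inst n d)}
    (D : Strategy R H) (G : FirstOrderChart R 𝓘) (I : Inst n d) : ℕ → List (Query R H × Bool)
  | 0 => []
  | k + 1 =>
    transcript D G I k ++ [(D (transcript D G I k), (D (transcript D G I k)).answer G I)]

/-- The strategy `D`, followed by the final computation `out` on its first `k` queries and
responses, reports an `ε`-approximate solution of every instance of `𝓘`, whatever the chart is. -/
def Reports {n d : ℕ} {R : ℝ} {H : PermissibleQueries n d} (𝓘 : Set (Inst n d)) (ε : ℝ)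
    (D : Strategy R H) (out : List (Query R H × Bool) → Vec n d) (k : ℕ) : Prop :=
  ∀ G : FirstOrderChart R 𝓘, ∀ I ∈ 𝓘, I.IsApproxSolution ε (out (transcript D G I k))

end MixedInteger

end

/-!
# Mixed-integer convex optimization with binary queries

The strategy is a cutting plane method on a finite set of candidate points. Write
`T = M * R / (min ρ 1 * ε)`. The convex combination, of weight `1 / (6 * T)` on the centre of its
ball, of an optimal solution and that centre is almost optimal, since `f` is Lipschitz on fibers,
and is itself the centre of a ball in the constraint set. So a mixed-integer grid of mesh
`r = min ρ 1 / (12 * T)` in the continuous coordinates contains a point `w` with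
`f w ≤ min f + ε / 2` and `supBall w r ⊆ C` (`exists_deep_grid_point`). The grid has at most
`(24 * T ^ 2) ^ (n + d)` points (`exists_grid`).

In each iteration, the method queries at a mixed-integer centerpoint `z` of the set of remaining
grid points (`exists_centerpoint`): every closed half-space with `z` on its boundary contains a
fraction `1 / (2 ^ n * (d + 1))` of them. Centerpoints come from the Helly number
`2 ^ n * (d + 1)` of `ℤⁿ × ℝᵈ`, applied to convex hulls of large subsets. That Helly number is
obtained from Helly's theorem in the continuous fibers and from Doignon's theorem for the
projections to the integer coordinates; the latter is a pigeonhole argument on parities for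
half-spaces that are relaxed as far as possible (`exists_card_le_of_forall_exists_le`).

Binary queries determine the coordinates of separating hyperplanes and subgradients, and the
function values, only approximately (`IsReadable`), but that suffices (`exists_cutting_step`). If
`z` is infeasible, the exact hyperplane leaves a margin `r` at `w`, so the approximate one does not
discard `w`. If `z` is feasible and an approximate subgradient discards `w`, then `f z` is at most
`f w + ε / 4`. Subgradients are bounded because `z` keeps the distance `r` from the boundary of the
box, where the values of `f` differ by at most `2 * M * R`. After `O(2 ^ n * d * (n + d) * log T)`
iterations no grid point remains, so `w` has been discarded at some point, and the feasible point
of least approximate value is an `ε`-approximate solution (`exists_reports`).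

The method is written as a decision tree (`DecisionTree`), whose depth is the number of queries, and
is then turned into a query strategy (`exists_strategy_of_decisionTree`).
-/

noncomputable section

namespace MixedInteger

/-! ### Helly's theorem for boxes of integer points -/

/-- A Helly theorem for open half-spaces on a finite set `L` of integer points that contains the
midpoints of its points of equal parity: if no point of `L` satisfies all the inequalities
`ℓ t x < γ t`, then already some `2 ^ n` of them have no common solution in `L`. -/
theorem exists_card_le_of_forall_exists_le {n : ℕ} {ι : Type*}
    (L : Finset (Fin n → ℤ))
    (hmid : ∀ p ∈ L, ∀ q ∈ L, (∀ i, (p i : ZMod 2) = q i) → ∃ c ∈ L, p + q = c + c)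
    (ℓ : ι → (Fin n → ℤ) →+ ℝ) (s : Finset ι) (γ : ι → ℝ)
    (hs : ∀ x ∈ L, ∃ t ∈ s, γ t ≤ ℓ t x) :
    ∃ T ⊆ s, T.card ≤ 2 ^ n ∧ ∀ x ∈ L, ∃ t ∈ T, γ t ≤ ℓ t x := by
  classical
  -- A subset of `s` of least cardinality without common solutions will do.
  obtain ⟨T, hTmem, hTmin⟩ := (s.powerset.filter
    fun T => ∀ x ∈ L, ∃ t ∈ T, γ t ≤ ℓ t x).exists_min_image Finset.card ⟨s, by simpa using hs⟩
  simp only [Finset.mem_filter, Finset.mem_powerset] at hTmem hTmin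
  obtain ⟨hTs, hT⟩ := hTmem
  refine ⟨T, hTs, ?_, hT⟩
  by_contra! hcard
  -- Among the right-hand sides `γ' ≥ γ` that still leave no common solution, choose one for which
  -- the half-spaces contain as many points of `L` as possible, counted with multiplicity.
  let good : (ι → ℝ) → Prop := fun γ' => (∀ t, γ t ≤ γ' t) ∧ ∀ x ∈ L, ∃ t ∈ T, γ' t ≤ ℓ t x
  let size : (ι → ℝ) → ℕ := fun γ' => ∑ t ∈ T, (L.filter fun x => ℓ t x < γ' t).card
  have hbdd : ∀ γ', size γ' ≤ T.card * L.card := fun γ' => by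
    simpa using Finset.sum_le_card_nsmul T _ L.card
      fun t _ => Finset.card_le_card (Finset.filter_subset _ _)
  obtain ⟨γ', hγ', hmax⟩ : ∃ γ', good γ' ∧ ∀ δ, good δ → size δ ≤ size γ' := by
    obtain ⟨γ', h1, h2⟩ := Nat.findGreatest_spec (P := fun k => ∃ γ', good γ' ∧ size γ' = k)
      (hbdd γ) ⟨γ, ⟨fun _ => le_rfl, hT⟩, rfl⟩
    exact ⟨γ', h1, fun δ hδ => h2 ▸ Nat.le_findGreatest (hbdd δ) ⟨δ, hδ, rfl⟩⟩
  -- By maximality, the half-space `t` can be pushed out to a point `q t` that satisfies all the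
  -- other inequalities, without gaining a point of `L` on the way.
  have hq : ∀ t : T, ∃ q ∈ L, (∀ u ∈ T, u ≠ t → ℓ u q < γ' u) ∧ γ' t ≤ ℓ t q ∧
      ∀ x ∈ L, ℓ t x < ℓ t q → ℓ t x < γ' t := by
    rintro ⟨t, ht⟩
    have hne : (L.filter fun x => ∀ u ∈ T, u ≠ t → ℓ u x < γ' u).Nonempty := by
      by_contra hempty
      have := hTmin (T.erase t) ⟨(Finset.erase_subset _ _).trans hTs, fun x hx => by
        by_contra! h
        refine hempty ⟨x, Finset.mem_filter.2 ⟨hx, fun u hu hut => ?_⟩⟩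
        exact (h u (Finset.mem_erase.2 ⟨hut, hu⟩)).trans_le (hγ'.1 u)⟩
      exact absurd this (not_le.2 (Finset.card_erase_lt_of_mem ht))
    obtain ⟨q, hqm, hqmin⟩ := Finset.exists_min_image _ (ℓ t) hne
    simp only [Finset.mem_filter] at hqm hqmin
    have hle : γ' t ≤ ℓ t q := by
      obtain ⟨u, hu, hle⟩ := hγ'.2 q hqm.1
      by_cases hut : u = t
      · exact hut ▸ hle
      · exact absurd (hqm.2 u hu hut) (not_lt.2 hle)
    refine ⟨q, hqm.1, hqm.2, hle, fun x hx hxq => ?_⟩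
    by_contra! hxt
    have hgood : good (Function.update γ' t (ℓ t q)) := by
      refine ⟨fun u => ?_, fun y hy => ?_⟩
      · by_cases hut : u = t
        · subst hut; simpa using (hγ'.1 u).trans hle
        · simpa [hut] using hγ'.1 u
      · by_contra! h
        refine absurd (hqmin y ⟨hy, fun u hu hut => by simpa [hut] using h u hu⟩) (not_le.2 ?_)
        simpa using h t ht
    refine absurd (hmax _ hgood) (not_le.2 (Finset.sum_lt_sum (fun u hu => ?_) ⟨t, ht, ?_⟩))
    · by_cases hut : u = t
      · subst hut
        exact Finset.card_le_card fun y hy => by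
          simp only [Function.update_self, Finset.mem_filter] at hy ⊢
          exact ⟨hy.1, hy.2.trans_le hle⟩
      · simp [hut]
    · refine Finset.card_lt_card ⟨fun y hy => ?_, fun hsub => ?_⟩
      · simp only [Function.update_self, Finset.mem_filter] at hy ⊢
        exact ⟨hy.1, hy.2.trans_le hle⟩
      · have := hsub (Finset.mem_filter.2 ⟨hx, by simpa using hxq⟩)
        exact absurd (Finset.mem_filter.1 this).2 (not_lt.2 hxt)
  choose q hqL hqlt hqle hqgap using hq
  -- Two of the points `q t` have equal parity; their midpoint satisfies all the inequalities.
  obtain ⟨a, b, hab, hpar⟩ : ∃ a b : T, a ≠ b ∧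
      (fun i => (q a i : ZMod 2)) = fun i => (q b i : ZMod 2) :=
    Fintype.exists_ne_map_eq_of_card_lt (fun (t : T) (i : Fin n) => (q t i : ZMod 2)) (by simpa)
  obtain ⟨c, hcL, hc⟩ := hmid _ (hqL a) _ (hqL b) fun i => congrFun hpar i
  have hℓ : ∀ t, ℓ t (q a) + ℓ t (q b) = ℓ t c + ℓ t c := fun t => by
    rw [← map_add, hc, map_add]
  obtain ⟨u, hu, hle⟩ := hγ'.2 c hcL
  refine absurd hle (not_le.2 ?_)
  have hne : (a : ι) ≠ b := fun h => hab (Subtype.ext h)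
  have h0 := hℓ u
  by_cases hua : u = a
  · subst hua
    exact hqgap a c hcL (by linarith [hqlt b a hu hne, hqle a])
  by_cases hub : u = b
  · subst hub
    exact hqgap b c hcL (by linarith [hqlt a b hu hne.symm, hqle b])
  linarith [hqlt a u hu hua, hqlt b u hu hub]

/-- Doignon's theorem on a box: if each integer point `x` of the box is missed by a convex set
`P x`, then some `2 ^ n` of these sets have no common integer point in the box. -/
theorem exists_card_le_of_convex {n : ℕ} (N : ℤ) (P : (Fin n → ℤ) → Set (Fin n → ℝ))
    (hP : ∀ x, Convex ℝ (P x)) (hx : ∀ x : Fin n → ℤ, (fun i => (x i : ℝ)) ∉ P x) :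
    ∃ T : Finset (Fin n → ℤ), T.card ≤ 2 ^ n ∧
      ∀ x : Fin n → ℤ, (∀ i, |x i| ≤ N) → ∃ t ∈ T, (fun i => (x i : ℝ)) ∉ P t := by
  classical
  let L : Finset (Fin n → ℤ) := Fintype.piFinset fun _ => Finset.Icc (-N) N
  have hL : ∀ x, x ∈ L ↔ ∀ i, |x i| ≤ N := fun x => by simp [L, abs_le]
  let e : (Fin n → ℤ) →+ (Fin n → ℝ) :=
    { toFun := fun x i => (x i : ℝ), map_zero' := by ext; simp, map_add' := by intros; ext; simp }
  have hsep : ∀ x : Fin n → ℤ, ∃ (g : (Fin n → ℝ) →L[ℝ] ℝ),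
      ∀ y ∈ L, e y ∈ P x → g (e y) < g (e x) := fun x => by
    have hfin : (e '' {y | y ∈ L ∧ e y ∈ P x}).Finite :=
      (L.finite_toSet.subset fun y hy => hy.1).image e
    obtain ⟨g, u, h1, h2⟩ := geometric_hahn_banach_closed_point
      (convex_convexHull ℝ (e '' {y | y ∈ L ∧ e y ∈ P x}))
      (hfin.isClosed_convexHull (𝕜 := ℝ))
      (x := e x) fun h => hx x (convexHull_min (by rintro _ ⟨y, hy, rfl⟩; exact hy.2) (hP x) h)
    exact ⟨g, fun y hy hyP => (h1 _ (subset_convexHull ℝ _ ⟨y, ⟨hy, hyP⟩, rfl⟩)).trans h2⟩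
  choose g hg using hsep
  obtain ⟨T, -, hcard, hT⟩ := exists_card_le_of_forall_exists_le L
    (fun p hp q hq hpq => by
      have h2 : ∀ i, ∃ c, p i + q i = c + c := fun i => by
        have : ((p i + q i : ℤ) : ZMod 2) = 0 := by
          push_cast; rw [hpq i]; exact CharTwo.add_self_eq_zero _
        obtain ⟨c, hc⟩ := (ZMod.intCast_zmod_eq_zero_iff_dvd _ 2).1 this
        exact ⟨c, by rw [hc]; push_cast; ring⟩
      choose c hc using h2
      refine ⟨c, (hL c).2 fun i => ?_, funext hc⟩
      have h3 := (hL p).1 hp i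
      have h4 := (hL q).1 hq i
      have h5 := hc i
      rw [abs_le] at *
      omega)
    (fun t => (g t : (Fin n → ℝ) →+ ℝ).comp e) L (fun t => g t (e t))
    fun x hx => ⟨x, hx, le_rfl⟩
  refine ⟨T, hcard, fun x hxN => ?_⟩
  obtain ⟨t, ht, hle⟩ := hT x ((hL x).2 hxN)
  exact ⟨t, ht, fun hmem => absurd (hg t x ((hL x).2 hxN) hmem) (not_lt.2 hle)⟩

/-! ### Mixed-integer centerpoints -/

/-- A Helly-type statement for the convex hulls of large subsets of a finite set `A` of
mixed-integer points. It combines Helly's theorem in the continuous fibers with Doignon's theorem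
for the projections of the intersections of `d + 1` hulls to the integer coordinates. -/
theorem exists_mem_convexHull_of_card_lt {n d : ℕ} (A : Finset (Vec n d)) (hA : A.Nonempty)
    (hint : ∀ a ∈ A, a ∈ integerPoints n d) :
    ∃ z ∈ integerPoints n d, ∀ B ⊆ A, 2 ^ n * (d + 1) * (A \ B).card < A.card →
      z ∈ convexHull ℝ (B : Set (Vec n d)) := by
  classical
  by_contra! hno
  let F : Finset (Finset (Vec n d)) :=
    A.powerset.filter fun B => 2 ^ n * (d + 1) * (A \ B).card < A.card
  have hF : ∀ B, B ∈ F ↔ B ⊆ A ∧ 2 ^ n * (d + 1) * (A \ B).card < A.card := fun B => by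
    simp [F]
  have hfib : ∀ x : Fin n → ℤ, ∃ G ⊆ F, G.card ≤ d + 1 ∧ ∀ y : Fin d → ℝ, ∃ B ∈ G,
      Sum.elim (fun i => (x i : ℝ)) y ∉ convexHull ℝ (B : Set (Vec n d)) := fun x => by
    by_contra! h
    obtain ⟨y, hy⟩ := Convex.helly_theorem' (𝕜 := ℝ) (s := F)
      (F := fun B : Finset (Vec n d) => {y : Fin d → ℝ |
        Sum.elim (fun i => (x i : ℝ)) y ∈ convexHull ℝ (B : Set (Vec n d))})
      (fun B _ => by
        intro y hy y' hy' a b ha hb hab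
        have := convex_convexHull ℝ (B : Set (Vec n d)) hy hy' ha hb hab
        simp only [Set.mem_ofPred_eq]
        convert this using 1
        ext (i | j)
        · simp [← add_mul, hab]
        · simp)
      (fun G hG hcard => by
        obtain ⟨y, hy⟩ := h G hG (by simpa using hcard)
        exact ⟨y, by simpa using hy⟩)
    obtain ⟨B, h1, h2, h3⟩ := hno (Sum.elim (fun i => (x i : ℝ)) y) fun i => ⟨x i, rfl⟩
    simp only [Set.mem_iInter, Set.mem_ofPred_eq] at hy
    exact h3 (hy B ((hF B).2 ⟨h1, h2⟩))
  choose G hGF hGcard hG using hfib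
  obtain ⟨N, hN⟩ : ∃ N : ℤ, ∀ a ∈ A, ∀ i : Fin n, |a (Sum.inl i)| ≤ N := by
    obtain ⟨N, hN⟩ := exists_int_gt (∑ a ∈ A, ∑ i : Fin n, |a (Sum.inl i)|)
    refine ⟨N, fun a ha i => le_trans ?_ hN.le⟩
    exact (Finset.single_le_sum (f := fun i : Fin n => |a (Sum.inl i)|) (fun _ _ => abs_nonneg _)
      (Finset.mem_univ i)).trans (Finset.single_le_sum
      (f := fun a : Vec n d => ∑ i : Fin n, |a (Sum.inl i)|)
      (fun _ _ => Finset.sum_nonneg fun _ _ => abs_nonneg _) ha)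
  obtain ⟨T, hTcard, hT⟩ := exists_card_le_of_convex N
    (fun x => {x' : Fin n → ℝ | ∃ y : Fin d → ℝ, ∀ B ∈ G x,
      Sum.elim x' y ∈ convexHull ℝ (B : Set (Vec n d))})
    (fun x => by
      rintro p ⟨y, hy⟩ p' ⟨y', hy'⟩ a b ha hb hab
      refine ⟨a • y + b • y', fun B hB => ?_⟩
      convert convex_convexHull ℝ (B : Set (Vec n d)) (hy B hB) (hy' B hB) ha hb hab using 1
      ext (i | j) <;> simp)
    (fun x ⟨y, hy⟩ => by
      obtain ⟨B, hB, hB'⟩ := hG x y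
      exact hB' (hy B hB))
  -- The chosen hulls are so few that some point of `A` lies in all of them.
  obtain ⟨a, haA, ha⟩ : ∃ a ∈ A, ∀ t ∈ T, ∀ B ∈ G t, a ∈ B := by
    by_contra! h
    have hsub : A ⊆ T.biUnion fun t => (G t).biUnion fun B => A \ B := fun a ha => by
      obtain ⟨t, ht, B, hB, haB⟩ := h a ha
      simp only [Finset.mem_biUnion, Finset.mem_sdiff]
      exact ⟨t, ht, B, hB, ha, haB⟩
    have hApos : 0 < A.card := hA.card_pos
    have hB : ∀ t ∈ T, ∀ B ∈ G t, 2 ^ n * (d + 1) * (A \ B).card ≤ A.card - 1 := fun t _ B hB => by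
      have := ((hF B).1 (hGF t hB)).2
      omega
    have h1 : A.card ≤ ∑ t ∈ T, ∑ B ∈ G t, (A \ B).card :=
      (Finset.card_le_card hsub).trans (Finset.card_biUnion_le.trans
        (Finset.sum_le_sum fun t _ => Finset.card_biUnion_le))
    have h2 : 2 ^ n * (d + 1) * A.card ≤ 2 ^ n * ((d + 1) * (A.card - 1)) := by
      refine (Nat.mul_le_mul_left _ h1).trans ?_
      rw [Finset.mul_sum]
      refine (Finset.sum_le_card_nsmul T _ ((d + 1) * (A.card - 1)) fun t ht => ?_).trans
        (Nat.mul_le_mul_right _ hTcard)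
      rw [Finset.mul_sum]
      exact (Finset.sum_le_card_nsmul (G t) _ (A.card - 1) (hB t ht)).trans
        (Nat.mul_le_mul_right _ (hGcard t))
    rw [← mul_assoc] at h2
    have := Nat.le_of_mul_le_mul_left h2 (by positivity)
    omega
  choose x hx using hint a haA
  obtain ⟨t, ht, hnot⟩ := hT x fun i => by
    have := hN a haA i
    rw [hx i] at this
    exact_mod_cast this
  refine hnot ⟨fun j => a (Sum.inr j), fun B hB => ?_⟩
  have heq : Sum.elim (fun i => (x i : ℝ)) (fun j => a (Sum.inr j)) = a := by
    ext (i | j)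
    · simp [hx i]
    · simp
  rw [heq]
  exact subset_convexHull ℝ _ (ha t ht B hB)

/-- Every nonempty finite set `A` of mixed-integer points has a mixed-integer centerpoint: each
closed half-space with the point on its boundary contains a fraction `1 / (2 ^ n * (d + 1))`
of `A`. -/
theorem exists_centerpoint {n d : ℕ} (A : Finset (Vec n d)) (hA : A.Nonempty)
    (hint : ∀ a ∈ A, a ∈ integerPoints n d) :
    ∃ z ∈ integerPoints n d, z ∈ convexHull ℝ (A : Set (Vec n d)) ∧ ∀ g : Vec n d,
      A.card ≤ 2 ^ n * (d + 1) * (A.filter fun a => g ⬝ᵥ z ≤ g ⬝ᵥ a).card := by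
  classical
  obtain ⟨z, hz, h⟩ := exists_mem_convexHull_of_card_lt A hA hint
  refine ⟨z, hz, h A subset_rfl (by simpa using hA.card_pos), fun g => ?_⟩
  by_contra! hlt
  have hmem := h (A.filter fun a => g ⬝ᵥ a < g ⬝ᵥ z) (Finset.filter_subset _ _) (by
    rw [← Finset.filter_not]
    simpa only [not_lt] using hlt)
  have hconv : Convex ℝ {a : Vec n d | g ⬝ᵥ a < g ⬝ᵥ z} :=
    convex_halfSpace_lt (IsLinearMap.mk (dotProduct_add g) fun c a => dotProduct_smul c g a) _
  have hz' := convexHull_min (fun a ha => (Finset.mem_filter.1 ha).2) hconv hmem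
  exact lt_irrefl (g ⬝ᵥ z) hz'

/-! ### Decision trees -/

/-- A decision tree with queries in `Q` and results in `α`. Each node asks a query and branches
on the binary response. -/
inductive DecisionTree (Q α : Type) : Type
  | leaf (a : α) : DecisionTree Q α
  | node (q : Q) (next : Bool → DecisionTree Q α) : DecisionTree Q α

namespace DecisionTree

variable {Q α β : Type}

/-- The result of a decision tree if the query `q` receives the response `ans q`. -/
def eval (ans : Q → Bool) : DecisionTree Q α → α
  | leaf a => a
  | node q next => (next (ans q)).eval ans

/-- The largest number of queries on a branch. -/
def depth : DecisionTree Q α → ℕ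
  | leaf _ => 0
  | node _ next => max (next true).depth (next false).depth + 1

/-- Run a decision tree, then another one that may depend on its result. -/
def bind (f : α → DecisionTree Q β) : DecisionTree Q α → DecisionTree Q β
  | leaf a => f a
  | node q next => node q fun b => (next b).bind f

theorem eval_bind (ans : Q → Bool) (f : α → DecisionTree Q β) (t : DecisionTree Q α) :
    (t.bind f).eval ans = (f (t.eval ans)).eval ans := by
  induction t with
  | leaf a => rfl
  | node q next ih => exact ih _

theorem depth_bind_le {f : α → DecisionTree Q β} {k : ℕ} (hf : ∀ a, (f a).depth ≤ k)
    (t : DecisionTree Q α) : (t.bind f).depth ≤ t.depth + k := by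
  induction t with
  | leaf a => simpa [bind, depth] using hf a
  | node q next ih =>
    have h1 := ih true
    have h2 := ih false
    simp only [bind, depth]
    omega

theorem depth_next_lt (q : Q) (next : Bool → DecisionTree Q α) (b : Bool) :
    (next b).depth < (node q next).depth := by
  cases b <;> simp only [depth] <;> omega

/-- The part of a decision tree that remains after the given responses. -/
def descend : DecisionTree Q α → List Bool → DecisionTree Q α
  | t, [] => t
  | leaf a, _ :: _ => leaf a
  | node _ next, b :: l => (next b).descend l

theorem descend_append (t : DecisionTree Q α) (l l' : List Bool) :
    t.descend (l ++ l') = (t.descend l).descend l' := by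
  induction l generalizing t with
  | nil => cases t <;> rfl
  | cons b l ih =>
    cases t with
    | leaf a => cases l' <;> rfl
    | node q next => exact ih _

/-- The query at the root, or `q₀` if there is none. -/
def rootQuery (q₀ : Q) : DecisionTree Q α → Q
  | leaf _ => q₀
  | node q _ => q

/-- The result at the root, or `a₀` if the tree still asks a query. -/
def rootResult (a₀ : α) : DecisionTree Q α → α
  | leaf a => a
  | node _ _ => a₀

theorem descend_singleton (q₀ : Q) (ans : Q → Bool) (t : DecisionTree Q α) :
    (t.descend [ans (t.rootQuery q₀)]).eval ans = t.eval ans ∧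
      (t.descend [ans (t.rootQuery q₀)]).depth ≤ t.depth - 1 := by
  cases t with
  | leaf a => exact ⟨rfl, Nat.zero_le _⟩
  | node q next =>
    refine ⟨by simp [descend, rootQuery, eval], ?_⟩
    have := depth_next_lt q next (ans q)
    simp only [descend, rootQuery]
    omega

theorem rootResult_eq_eval (a₀ : α) (ans : Q → Bool) {t : DecisionTree Q α} (ht : t.depth = 0) :
    t.rootResult a₀ = t.eval ans := by
  cases t with
  | leaf a => rfl
  | node q next => simp [depth] at ht

/-- Run finitely many decision trees, one for each coordinate, and collect their results. -/
theorem exists_pi {ι : Type} [Fintype ι] (t : ι → DecisionTree Q α) (k : ℕ)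
    (ht : ∀ i, (t i).depth ≤ k) :
    ∃ u : DecisionTree Q (ι → α), u.depth ≤ Fintype.card ι * k ∧
      ∀ ans i, u.eval ans i = (t i).eval ans := by
  classical
  suffices h : ∀ s : Finset ι, ∃ u : DecisionTree Q (ι → α), u.depth ≤ s.card * k ∧
      ∀ ans, ∀ i ∈ s, u.eval ans i = (t i).eval ans by
    obtain ⟨u, h1, h2⟩ := h Finset.univ
    exact ⟨u, h1, fun ans i => h2 ans i (Finset.mem_univ i)⟩
  intro s
  induction s using Finset.induction_on with
  | empty =>
    -- The empty set asks no query; any value of the leaf will do.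
    refine ⟨leaf fun i => (t i).eval fun _ => true, by simp [depth], by simp⟩
  | insert j s hj ih =>
    obtain ⟨u, hu, hu'⟩ := ih
    refine ⟨u.bind fun v => (t j).bind fun a => leaf (Function.update v j a), ?_, ?_⟩
    · refine (depth_bind_le (k := k) (fun v => ?_) u).trans ?_
      · exact (depth_bind_le (k := 0) (fun a => le_rfl) (t j)).trans (ht j)
      · rw [Finset.card_insert_of_notMem hj, Nat.succ_mul]
        omega
    · intro ans i hi
      rw [eval_bind, eval_bind]
      by_cases hij : i = j
      · subst hij; simp [eval]
      · simp only [eval, Function.update_of_ne hij]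
        exact hu' ans i ((Finset.mem_insert.1 hi).resolve_left hij)

end DecisionTree

open DecisionTree

/-- A decision tree for the queries of an oracle is a query strategy: the query and the report
are read off the part of the tree that remains after the responses so far. -/
theorem exists_strategy_of_decisionTree {n d : ℕ} {R : ℝ} {H : PermissibleQueries n d}
    {𝓘 : Set (Inst n d)} {ε : ℝ} (q₀ : Query R H) (t : DecisionTree (Query R H) (Vec n d))
    (ht : ∀ G : FirstOrderChart R 𝓘, ∀ I ∈ 𝓘,
      I.IsApproxSolution ε (t.eval fun q => q.answer G I)) :
    ∃ (D : Strategy R H) (out : List (Query R H × Bool) → Vec n d),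
      Reports 𝓘 ε D out t.depth := by
  refine ⟨fun l => (t.descend (l.map Prod.snd)).rootQuery q₀,
    fun l => (t.descend (l.map Prod.snd)).rootResult 0, fun G I hI => ?_⟩
  set D : Strategy R H := fun l => (t.descend (l.map Prod.snd)).rootQuery q₀ with hD
  have key : ∀ k, (t.descend ((transcript D G I k).map Prod.snd)).eval (fun q => q.answer G I) =
      t.eval (fun q => q.answer G I) ∧
      (t.descend ((transcript D G I k).map Prod.snd)).depth ≤ t.depth - k := by
    intro k
    induction k with
    | zero =>
      have h0 : t.descend [] = t := by cases t <;> rfl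
      simp [transcript, h0]
    | succ k ih =>
      have := descend_singleton q₀ (fun q : Query R H => q.answer G I)
        (t.descend ((transcript D G I k).map Prod.snd))
      simp only [transcript, List.map_append, List.map_cons, List.map_nil, descend_append]
      exact ⟨this.1.trans ih.1, by have h1 := this.2; have h2 := ih.2; simp only [hD] at *; omega⟩
  obtain ⟨h1, h2⟩ := key t.depth
  have h3 := rootResult_eq_eval (0 : Vec n d) (fun q : Query R H => q.answer G I)
    (Nat.le_zero.1 (h2.trans (Nat.sub_self _).le))
  simp only [h3, h1]
  exact ht G I hI

/-! ### Reading a real number by binary queries -/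

/-- The functions in `Φ` allow to read a real number with few queries: a number of absolute value
at most `B` is determined up to `η` by a decision tree of depth logarithmic in `B / η`. The queries
in `Q` stand for the application of functions in `Φ` to an unknown number `s`. -/
def IsReadable (Φ : Set (ℝ → Bool)) : Prop :=
  ∀ (Q : Type) (q : Φ → Q) (B η x : ℝ), 0 < η → 1 ≤ x → B ≤ x * η →
    ∃ t : DecisionTree Q ℝ, (t.depth : ℝ) ≤ 2 * Real.log x + 4 ∧
      ∀ (ans : Q → Bool) (s : ℝ), (∀ h, ans (q h) = h.1 s) → |s| ≤ B → |t.eval ans - s| ≤ η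

theorem exists_two_mul_le_two_pow {x : ℝ} (hx : 1 ≤ x) :
    ∃ N : ℕ, 2 * x ≤ 2 ^ N ∧ (N : ℝ) ≤ 2 * Real.log x + 3 := by
  have hlog2 := Real.log_two_gt_d9
  have hlx := Real.log_nonneg hx
  refine ⟨⌈Real.logb 2 (2 * x)⌉₊, ?_, ?_⟩
  · rw [← Real.rpow_natCast, ← Real.logb_le_iff_le_rpow (by norm_num) (by positivity)]
    exact Nat.le_ceil _
  · have h0 : 0 ≤ Real.logb 2 (2 * x) := Real.logb_nonneg (by norm_num) (by linarith)
    have h1 := Nat.ceil_lt_add_one h0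
    have h2 : Real.logb 2 (2 * x) ≤ 2 * Real.log x + 1 + 1 := by
      rw [Real.logb, Real.log_mul (by norm_num) (by positivity),
        div_le_iff₀ (by linarith)]
      nlinarith
    linarith

/-- The digits of `|s|` above the weight `2 ^ j`, from the most significant one downwards. -/
def floorTree {Q : Type} (q : ℤ → Q) : ℕ → ℤ → DecisionTree Q ℤ
  | 0, _ => leaf 0
  | N + 1, j => (floorTree q N (j + 1)).bind fun m =>
      node (q j) fun b => leaf (2 * m + if b then 1 else 0)

theorem depth_floorTree_le {Q : Type} (q : ℤ → Q) (N : ℕ) (j : ℤ) :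
    (floorTree q N j).depth ≤ N := by
  induction N generalizing j with
  | zero => simp [floorTree, depth]
  | succ N ih =>
    exact (depth_bind_le (k := 1) (fun m => by simp [depth]) _).trans
      (Nat.add_le_add_right (ih _) 1)

theorem eval_floorTree {Q : Type} (q : ℤ → Q) (ans : Q → Bool) (s : ℝ)
    (hq : ∀ j, ans (q j) = binaryDigit j s) (N : ℕ) (j : ℤ) (hs : |s| < 2 ^ (j + N)) :
    (floorTree q N j).eval ans = ⌊|s| / 2 ^ j⌋ := by
  induction N generalizing j with
  | zero =>
    have hp : (0 : ℝ) < 2 ^ j := by positivity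
    simp only [floorTree, eval]
    symm
    rw [Int.floor_eq_zero_iff]
    exact ⟨by positivity, by rw [div_lt_one hp]; simpa using hs⟩
  | succ N ih =>
    have h1 := ih (j + 1) (by convert hs using 2; push_cast; ring)
    have h2 : ⌊|s| / (2 : ℝ) ^ (j + 1)⌋ = ⌊|s| / (2 : ℝ) ^ j⌋ / 2 := by
      rw [zpow_add_one₀ (by norm_num), ← div_div]
      exact_mod_cast Int.floor_div_natCast (|s| / (2 : ℝ) ^ j) 2
    simp only [floorTree, eval_bind, eval, h1, h2, hq, binaryDigit, decide_eq_true_eq]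
    split_ifs <;> omega

theorem isReadable_bitFunctions : IsReadable bitFunctions := by
  intro Q q B η x hη hx hB
  -- `2 ^ j` is the weight of the last digit that is needed.
  obtain ⟨j, hj1, hj2⟩ := exists_mem_Ico_zpow hη (one_lt_two (α := ℝ))
  obtain ⟨N, hN, hN'⟩ := exists_two_mul_le_two_pow hx
  have hp : (0 : ℝ) < 2 ^ j := by positivity
  let qd : ℤ → Q := fun j => q ⟨binaryDigit j, Or.inr ⟨j, rfl⟩⟩
  let sgn : ℤ → DecisionTree Q ℝ := fun m => node (q ⟨signBit, Or.inl rfl⟩) fun b =>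
    leaf (if b then -(m * 2 ^ j : ℝ) else m * 2 ^ j)
  refine ⟨(floorTree qd N j).bind sgn, ?_, fun ans s hans hs => ?_⟩
  · have h1 : ((floorTree qd N j).bind sgn).depth ≤ N + 1 :=
      (depth_bind_le (fun m => by simp [sgn, depth]) _).trans
        (Nat.add_le_add_right (depth_floorTree_le qd N j) 1)
    have h2 : (((floorTree qd N j).bind sgn).depth : ℝ) ≤ N + 1 := by exact_mod_cast h1
    linarith
  · have hlt : |s| < 2 ^ (j + N) := by
      rw [zpow_add₀ (by norm_num), zpow_natCast]
      rw [zpow_add_one₀ (by norm_num)] at hj2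
      calc |s| ≤ x * η := hs.trans hB
        _ < x * (2 ^ j * 2) := by gcongr
        _ = 2 ^ j * (2 * x) := by ring
        _ ≤ 2 ^ j * 2 ^ N := by gcongr
    have hfl := eval_floorTree qd ans s (fun j => hans _) N j hlt
    simp only [sgn, eval_bind, eval, hfl, hans, signBit, decide_eq_true_eq]
    have h1 : (⌊|s| / 2 ^ j⌋ : ℝ) * 2 ^ j ≤ |s| := by
      rw [← le_div_iff₀ hp]; exact Int.floor_le _
    have h2 : |s| ≤ (⌊|s| / 2 ^ j⌋ : ℝ) * 2 ^ j + 2 ^ j := by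
      have := (Int.lt_floor_add_one (|s| / (2 : ℝ) ^ j)).le
      rw [div_le_iff₀ hp] at this
      linarith
    rw [abs_le]
    split_ifs with hneg
    · rw [abs_of_neg hneg] at *
      constructor <;> linarith
    · rw [abs_of_nonneg (not_lt.1 hneg)] at *
      constructor <;> linarith

/-- Bisection of the interval `[c, c + 2 ^ N * η]`. -/
def bisectTree {Q : Type} (q : ℝ → Q) (η : ℝ) : ℕ → ℝ → DecisionTree Q ℝ
  | 0, c => leaf c
  | N + 1, c => node (q (c + 2 ^ N * η)) fun b =>
      bisectTree q η N (if b then c + 2 ^ N * η else c)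

theorem depth_bisectTree {Q : Type} (q : ℝ → Q) (η : ℝ) (N : ℕ) (c : ℝ) :
    (bisectTree q η N c).depth = N := by
  induction N generalizing c with
  | zero => rfl
  | succ N ih => simp [bisectTree, depth, ih]

theorem eval_bisectTree {Q : Type} (q : ℝ → Q) (η : ℝ) (ans : Q → Bool) (s : ℝ)
    (hq : ∀ c, ans (q c) = decide (c ≤ s)) (N : ℕ) (c : ℝ) (h1 : c ≤ s)
    (h2 : s ≤ c + 2 ^ N * η) : |(bisectTree q η N c).eval ans - s| ≤ η := by
  induction N generalizing c with
  | zero =>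
    simp only [bisectTree, eval]
    rw [abs_le]
    constructor <;> linarith
  | succ N ih =>
    rw [pow_succ] at h2
    simp only [bisectTree, eval, hq, decide_eq_true_eq]
    split_ifs with h
    · exact ih _ h (by linarith)
    · exact ih _ h1 (by linarith)

theorem isReadable_thresholds :
    IsReadable {h | ∃ c : ℝ, h = fun t => decide (c ≤ t)} := by
  intro Q q B η x hη hx hB
  obtain ⟨N, hN, hN'⟩ := exists_two_mul_le_two_pow hx
  refine ⟨bisectTree (fun c => q ⟨_, c, rfl⟩) η N (-B), ?_, fun ans s hans hs => ?_⟩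
  · rw [depth_bisectTree]
    linarith
  · rw [abs_le] at hs
    refine eval_bisectTree _ η ans s (fun c => hans _) N (-B) hs.1 ?_
    have := mul_le_mul_of_nonneg_right hN hη.le
    linarith

/-- Bit queries and inner product threshold queries both allow to apply a class of readable
functions to values and to the coordinates of vectors. -/
theorem exists_isReadable {n d : ℕ} {H : PermissibleQueries n d}
    (hH : H = bitQueries n d ∨ H = dirQueries n d) :
    ∃ Φ : Set (ℝ → Bool), IsReadable Φ ∧ ∀ h ∈ Φ, h ∈ H.val ∧
      ∀ i, (fun g : Vec n d => h (g i)) ∈ H.sep ∧ (fun g : Vec n d => h (g i)) ∈ H.sub := by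
  rcases hH with rfl | rfl
  · exact ⟨bitFunctions, isReadable_bitFunctions, fun h hh =>
      ⟨hh, fun i => ⟨⟨i, h, hh, rfl⟩, ⟨i, h, hh, rfl⟩⟩⟩⟩
  · refine ⟨_, isReadable_thresholds, ?_⟩
    rintro _ ⟨c, rfl⟩
    refine ⟨⟨1, c, by simp⟩, fun i => ⟨⟨Pi.single i 1, c, by simp⟩, ⟨Pi.single i 1, c, by simp⟩⟩⟩

/-- Read all coordinates of a vector. -/
theorem IsReadable.exists_vector {n d : ℕ} {Φ : Set (ℝ → Bool)} (hΦ : IsReadable Φ) {Q : Type}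
    (q : Fin n ⊕ Fin d → Φ → Q) {B η x : ℝ} (hη : 0 < η) (hx : 1 ≤ x) (hB : B ≤ x * η) :
    ∃ t : DecisionTree Q (Vec n d), (t.depth : ℝ) ≤ (n + d) * (2 * Real.log x + 4) ∧
      ∀ (ans : Q → Bool) (g : Vec n d), (∀ i h, ans (q i h) = h.1 (g i)) →
        (∀ i, |g i| ≤ B) → ∀ i, |t.eval ans i - g i| ≤ η := by
  choose t ht ht' using fun i => hΦ Q (q i) B η x hη hx hB
  have hlog := Real.log_nonneg hx
  obtain ⟨u, hu, hu'⟩ := exists_pi t ⌊2 * Real.log x + 4⌋₊ fun i => Nat.le_floor (ht i)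
  refine ⟨u, ?_, fun ans g hans hg i => ?_⟩
  · have h1 : (u.depth : ℝ) ≤ ((n + d : ℕ) : ℝ) * (⌊2 * Real.log x + 4⌋₊ : ℝ) := by
      simp only [Fintype.card_sum, Fintype.card_fin] at hu
      exact_mod_cast hu
    have h2 := Nat.floor_le (show 0 ≤ 2 * Real.log x + 4 by linarith)
    push_cast at h1
    exact h1.trans (by gcongr)
  · rw [hu']
    exact ht' i ans (g i) (hans i) (hg i)

/-! ### Cutting planes from approximate first-order information -/

theorem abs_dotProduct_le {n d : ℕ} {g u : Vec n d} {η D : ℝ} (hη : 0 ≤ η)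
    (hg : ∀ i, |g i| ≤ η) (hu : ∀ i, |u i| ≤ D) : |g ⬝ᵥ u| ≤ (n + d) * (η * D) := by
  calc |g ⬝ᵥ u| ≤ ∑ i, |g i * u i| := Finset.abs_sum_le_sum_abs _ _
    _ ≤ ∑ _i : Fin n ⊕ Fin d, η * D := Finset.sum_le_sum fun i _ => by
        rw [abs_mul]
        exact mul_le_mul (hg i) (hu i) (abs_nonneg _) hη
    _ = (n + d) * (η * D) := by simp

theorem abs_apply_le_one {n d : ℕ} {g : Vec n d} (hg : g ⬝ᵥ g = 1) (i : Fin n ⊕ Fin d) :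
    |g i| ≤ 1 := by
  have h : g i * g i ≤ g ⬝ᵥ g := Finset.single_le_sum (f := fun i => g i * g i)
    (fun i _ => mul_self_nonneg _) (Finset.mem_univ i)
  rw [hg] at h
  exact abs_le_one_iff_mul_self_le_one.2 h

/-- A separating hyperplane leaves a margin `r` at the centre of a ball of radius `r` in the
constraint set. -/
theorem dotProduct_add_radius_lt {n d : ℕ} {C : Set (Vec n d)} {g z w : Vec n d} {r : ℝ}
    (hr : 0 ≤ r) (hw : supBall w r ⊆ C) (hg : g ⬝ᵥ g = 1)
    (hsep : ∀ w' ∈ C, g ⬝ᵥ w' < g ⬝ᵥ z) : g ⬝ᵥ w + r < g ⬝ᵥ z := by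
  have h := hsep (w + r • g) (hw fun i => by
    simpa [abs_mul, abs_of_nonneg hr] using mul_le_mul_of_nonneg_left (abs_apply_le_one hg i) hr)
  simpa [dotProduct_add, dotProduct_smul, hg] using h

/-- A subgradient at a point at distance `r` from the boundary of the box is bounded by the
oscillation of the function, divided by `r`. -/
theorem abs_subgradient_le {n d : ℕ} {f : Vec n d → ℝ} {g z : Vec n d} {R r V : ℝ} (hr : 0 < r)
    (hz : z ∈ box n d (R - r)) (hosc : ∀ z ∈ box n d R, ∀ w ∈ box n d R, f z - f w ≤ V)
    (hg : ∀ w, f z + g ⬝ᵥ (w - z) ≤ f w) (i : Fin n ⊕ Fin d) : |g i| ≤ V / r := by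
  classical
  have hzR : z ∈ box n d R := fun j => (hz j).trans (by linarith)
  have key : ∀ s : ℝ, |s| ≤ r → g i * s ≤ V := fun s hs => by
    have h1 := hg (z + Pi.single i s)
    have h2 : z + Pi.single i s ∈ box n d R := fun j => by
      by_cases hj : j = i
      · subst hj
        have := (abs_add_le (z j) s).trans (add_le_add (hz j) hs)
        simpa using this
      · simpa [hj] using hzR j
    have h3 := hosc _ h2 z hzR
    rw [add_sub_cancel_left, dotProduct_single] at h1
    linarith
  rw [le_div_iff₀ hr]
  have h1 := key r (abs_of_pos hr).le
  have h2 := key (-r) (by rw [abs_neg, abs_of_pos hr])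
  rcases abs_cases (g i) with ⟨h, -⟩ | ⟨h, -⟩ <;> rw [h] <;> linarith

/-- One step of the cutting plane method at the point `z`: with few queries, find out whether `z`
is feasible, read its value up to `ε / 16` if it is, and find a vector `g` such that the half-space
`{a | g ⬝ᵥ z ≤ g ⬝ᵥ a}` does not contain the centre `w` of a ball of radius `r` in the constraint
set, unless `z` is feasible and almost as good as `w`. -/
theorem exists_cutting_step {n d : ℕ} {R ρ M U ε r xs xg xv : ℝ}
    {H : PermissibleQueries n d} {Φ : Set (ℝ → Bool)} (hΦ : IsReadable Φ)
    (hH : ∀ h ∈ Φ, h ∈ H.val ∧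
      ∀ i, (fun g : Vec n d => h (g i)) ∈ H.sep ∧ (fun g : Vec n d => h (g i)) ∈ H.sub)
    (hd : 1 ≤ d) (hr : 0 < r) (hrR : r ≤ R) (hε : 0 < ε)
    (hxs : 1 ≤ xs) (hxs' : 1 ≤ xs * (r / (4 * (n + d) * R)))
    (hxg : 1 ≤ xg) (hxg' : 2 * M * R / r ≤ xg * (ε / (8 * (n + d) * R)))
    (hxv : 1 ≤ xv) (hxv' : U ≤ xv * (ε / 16)) :
    ∃ step : Vec n d → DecisionTree (Query R H) (Option ℝ × Vec n d),
      (∀ z, ((step z).depth : ℝ) ≤ (n + d) * (2 * Real.log xs + 4) +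
        ((n + d) * (2 * Real.log xg + 4) + (2 * Real.log xv + 4))) ∧
      ∀ (G : FirstOrderChart R (deepInstances n d R ρ M U)), ∀ I ∈ deepInstances n d R ρ M U,
        ∀ z ∈ box n d (R - r), z ∈ integerPoints n d → ∀ w, supBall w r ⊆ I.C →
          (∀ v, ((step z).eval fun q => q.answer G I).1 = some v →
            z ∈ I.feasible ∧ |v - I.f z| ≤ ε / 16) ∧
          (((step z).eval fun q => q.answer G I).2 ⬝ᵥ z ≤
              ((step z).eval fun q => q.answer G I).2 ⬝ᵥ w →
            ∃ v, ((step z).eval fun q => q.answer G I).1 = some v ∧ I.f z ≤ I.f w + ε / 4) := by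
  classical
  have hR : 0 < R := hr.trans_le hrR
  have hd' : (1 : ℝ) ≤ d := by exact_mod_cast hd
  have hm : (1 : ℝ) ≤ n + d := by have : (0 : ℝ) ≤ n := n.cast_nonneg; linarith
  set ηs : ℝ := r / (4 * (n + d) * R) with hηs
  set ηg : ℝ := ε / (8 * (n + d) * R) with hηg
  have hηs0 : 0 < ηs := by positivity
  have hηg0 : 0 < ηg := by positivity
  have hlog := Real.log_nonneg hxs
  have hlog' := Real.log_nonneg hxg
  have hlog'' := Real.log_nonneg hxv
  have hsteps : ∀ z : Vec n d, ∃ t : DecisionTree (Query R H) (Option ℝ × Vec n d),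
      (t.depth : ℝ) ≤ (n + d) * (2 * Real.log xs + 4) +
        ((n + d) * (2 * Real.log xg + 4) + (2 * Real.log xv + 4)) ∧
      ∀ (G : FirstOrderChart R (deepInstances n d R ρ M U)), ∀ I ∈ deepInstances n d R ρ M U,
        z ∈ box n d (R - r) → z ∈ integerPoints n d → ∀ w, supBall w r ⊆ I.C →
          (∀ v, (t.eval fun q => q.answer G I).1 = some v →
            z ∈ I.feasible ∧ |v - I.f z| ≤ ε / 16) ∧
          ((t.eval fun q => q.answer G I).2 ⬝ᵥ z ≤ (t.eval fun q => q.answer G I).2 ⬝ᵥ w →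
            ∃ v, (t.eval fun q => q.answer G I).1 = some v ∧ I.f z ≤ I.f w + ε / 4) := by
    intro z
    by_cases hzb : z ∈ box n d (R - r)
    swap
    · exact ⟨leaf (none, 0), by simp only [depth]; push_cast; positivity,
        fun G I hI hz => absurd hz hzb⟩
    have hzR : z ∈ box n d R := fun j => (hzb j).trans (by linarith)
    obtain ⟨ts, hts, hts'⟩ := hΦ.exists_vector (n := n) (d := d) (B := 1) (η := ηs) (x := xs)
      (fun i h => Query.sep (H := H) (⟨z, hzR⟩ : box n d R) ⟨_, ((hH h.1 h.2).2 i).1⟩)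
      hηs0 hxs hxs'
    obtain ⟨tg, htg, htg'⟩ := hΦ.exists_vector (n := n) (d := d) (B := 2 * M * R / r) (η := ηg)
      (x := xg)
      (fun i h => Query.sub (H := H) (⟨z, hzR⟩ : box n d R) ⟨_, ((hH h.1 h.2).2 i).2⟩)
      hηg0 hxg hxg'
    obtain ⟨tv, htv, htv'⟩ := hΦ (Query R H)
      (fun h => Query.val (H := H) (⟨z, hzR⟩ : box n d R) ⟨_, (hH h.1 h.2).1⟩) U (ε / 16) xv
      (by positivity) hxv hxv'
    let rest : Vec n d → DecisionTree (Query R H) (Option ℝ × Vec n d) := fun gs =>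
      if ∀ i, |gs i| ≤ ηs then tg.bind fun g => tv.bind fun v => leaf (some v, g)
      else leaf (none, gs)
    refine ⟨ts.bind rest, ?_, fun G I hI _ hzi w hw => ?_⟩
    · have h1 : ∀ gs, (rest gs).depth ≤ tg.depth + tv.depth := fun gs => by
        simp only [rest]
        split_ifs
        · exact depth_bind_le (fun g => depth_bind_le (k := 0) (fun v => le_rfl) tv) tg
        · exact Nat.zero_le _
      have h2 : ((ts.bind rest).depth : ℝ) ≤ ts.depth + (tg.depth + tv.depth) := by
        exact_mod_cast depth_bind_le h1 ts
      linarith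
    have hI' := hI
    obtain ⟨⟨hCbox, -, -⟩, -, -, hval, hosc⟩ := hI'
    have hwC : w ∈ I.C := hw fun i => by simpa using hr.le
    have hdiff : ∀ i, |(w - z) i| ≤ 2 * R := fun i => by
      have h1 := hCbox hwC i
      have h2 := hzR i
      rw [Pi.sub_apply]
      rw [abs_le] at *
      constructor <;> linarith
    set ans : Query R H → Bool := fun q => q.answer G I with hans
    set zb : box n d R := ⟨z, hzR⟩ with hzb'
    by_cases hzC : z ∈ I.C
    · have h0 := G.sep_of_mem zb I hI hzC
      have hsmall : ∀ i, |ts.eval ans i| ≤ ηs := fun i => by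
        simpa [h0] using hts' ans (G.sep zb I) (fun _ _ => rfl) (fun i => by simp [h0]) i
      have hsub := G.sub_mem zb I hI
      have hg := htg' ans (G.sub zb I) (fun _ _ => rfl) (abs_subgradient_le hr hzb hosc hsub)
      have hv := htv' ans (G.val zb I) (fun _ => rfl) (by
        rw [G.val_eq zb I hI]; exact abs_le.2 (hval z hzR))
      rw [G.val_eq zb I hI] at hv
      have heval : (ts.bind rest).eval ans = (some (tv.eval ans), tg.eval ans) := by
        rw [eval_bind]
        simp only [rest, if_pos hsmall, eval_bind, eval]
      rw [heval]
      refine ⟨fun v hv' => ?_, fun hcut => ⟨_, rfl, ?_⟩⟩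
      · obtain rfl := Option.some.inj hv'
        exact ⟨⟨hzC, hzi⟩, hv⟩
      · have h1 := abs_dotProduct_le (g := tg.eval ans - G.sub zb I) hηg0.le hg hdiff
        have h2 : (n + d : ℝ) * (ηg * (2 * R)) = ε / 4 := by
          rw [hηg]; field_simp; norm_num
        have h3 := hsub w
        simp only [hzb'] at h3
        rw [h2, sub_dotProduct, abs_le] at h1
        have h4 : tg.eval ans ⬝ᵥ (w - z) = tg.eval ans ⬝ᵥ w - tg.eval ans ⬝ᵥ z :=
          dotProduct_sub _ _ _
        simp only at hcut
        linarith [h1.2]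
    · obtain ⟨h0, hsep⟩ := G.sep_of_notMem zb I hI hzC
      have hg := hts' ans (G.sep zb I) (fun _ _ => rfl) (abs_apply_le_one h0)
      have hbig : ¬∀ i, |ts.eval ans i| ≤ ηs := fun hall => by
        have hle : ∀ i, |G.sep zb I i| ≤ 2 * ηs := fun i => by
          have h1 := hall i
          have h2 := hg i
          rw [abs_le] at *
          constructor <;> linarith
        have h1 := abs_dotProduct_le (by positivity) hle hle
        rw [h0, abs_one] at h1
        have h2 : ηs ≤ 1 / (4 * (n + d)) := by
          rw [hηs, div_le_div_iff₀ (by positivity) (by positivity)]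
          nlinarith
        have h3 : (n + d : ℝ) * (2 * ηs) ≤ 1 / 2 := by
          calc (n + d : ℝ) * (2 * ηs) ≤ (n + d) * (2 * (1 / (4 * (n + d)))) := by gcongr
            _ = 1 / 2 := by field_simp; norm_num
        have h4 : 2 * ηs ≤ 1 / 2 := le_trans (by nlinarith) h3
        nlinarith
      have heval : (ts.bind rest).eval ans = (none, ts.eval ans) := by
        rw [eval_bind]
        simp only [rest, if_neg hbig, eval]
      rw [heval]
      refine ⟨fun v hv => by simp at hv, fun hcut => absurd hcut (not_le.2 ?_)⟩
      have h1 := abs_dotProduct_le (g := ts.eval ans - G.sep zb I) hηs0.le hg hdiff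
      have h2 : (n + d : ℝ) * (ηs * (2 * R)) = r / 2 := by
        rw [hηs]; field_simp; norm_num
      have h3 := dotProduct_add_radius_lt hr.le hw h0 hsep
      simp only [hzb'] at h3
      rw [h2, sub_dotProduct, abs_le] at h1
      have h4 : ts.eval ans ⬝ᵥ (w - z) = ts.eval ans ⬝ᵥ w - ts.eval ans ⬝ᵥ z :=
        dotProduct_sub _ _ _
      have h5 : G.sep zb I ⬝ᵥ (w - z) = G.sep zb I ⬝ᵥ w - G.sep zb I ⬝ᵥ z :=
        dotProduct_sub _ _ _
      simp only
      linarith [h1.2]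
  choose step h1 h2 using hsteps
  exact ⟨step, h1, fun G I hI z hz hzi w hw => h2 z G I hI hz hzi w hw⟩

/-! ### The cutting plane method on a finite set -/

/-- The cutting plane method on a finite set `A`: run the decision tree `step` at the point
`center A` and discard the points of `A` in the half-space that it cuts off. The result lists the
points that were found feasible, together with their approximate values. -/
def search {n d : ℕ} {Q : Type} (step : Vec n d → DecisionTree Q (Option ℝ × Vec n d))
    (center : Finset (Vec n d) → Vec n d) :
    ℕ → Finset (Vec n d) → DecisionTree Q (List (Vec n d × ℝ))
  | 0, _ => leaf []
  | k + 1, A => (step (center A)).bind fun p =>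
      (search step center k (A.filter fun a => p.2 ⬝ᵥ a < p.2 ⬝ᵥ center A)).bind fun l =>
        leaf ((p.1.map fun v => (center A, v)).toList ++ l)

section Search

variable {n d : ℕ} {Q : Type} {step : Vec n d → DecisionTree Q (Option ℝ × Vec n d)}
  {center : Finset (Vec n d) → Vec n d} {ans : Q → Bool}

theorem depth_search_le {s : ℕ} (hs : ∀ z, (step z).depth ≤ s) (k : ℕ) (A : Finset (Vec n d)) :
    (search step center k A).depth ≤ k * s := by
  induction k generalizing A with
  | zero => simp [search, depth]
  | succ k ih =>
    refine (depth_bind_le (k := k * s) (fun p => ?_) _).trans ?_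
    · exact (depth_bind_le (k := 0) (fun l => le_rfl) _).trans (ih _)
    · have := hs (center A)
      rw [Nat.succ_mul]
      omega

theorem forall_mem_search {good : Vec n d → ℝ → Prop}
    (hgood : ∀ A v, ((step (center A)).eval ans).1 = some v → good (center A) v)
    (k : ℕ) (A : Finset (Vec n d)) :
    ∀ p ∈ (search step center k A).eval ans, good p.1 p.2 := by
  induction k generalizing A with
  | zero => simp [search, eval]
  | succ k ih =>
    intro p hp
    simp only [search, eval_bind, eval, List.mem_append, Option.mem_toList,
      Option.map_eq_some_iff] at hp
    rcases hp with ⟨v, hv, rfl⟩ | hp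
    · exact hgood A v hv
    · exact ih _ p hp

/-- If each cut discards at least the fraction `1 / h`, then all points are discarded in the end.
So there is an iteration that discards the point `w`. -/
theorem exists_mem_search {hit : Vec n d → Prop} {w : Vec n d} {P : Finset (Vec n d)} {h : ℕ}
    (hh : 0 < h)
    (hcenter : ∀ A ⊆ P, A.Nonempty → ∀ g : Vec n d,
      A.card ≤ h * (A.filter fun a => g ⬝ᵥ center A ≤ g ⬝ᵥ a).card)
    (hhit : ∀ A, ((step (center A)).eval ans).2 ⬝ᵥ center A ≤
        ((step (center A)).eval ans).2 ⬝ᵥ w →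
      ∃ v, ((step (center A)).eval ans).1 = some v ∧ hit (center A))
    (k : ℕ) (A : Finset (Vec n d)) (hAP : A ⊆ P) (hw : w ∈ A)
    (hk : (A.card : ℝ) * (1 - 1 / h) ^ k < 1) :
    ∃ p ∈ (search step center k A).eval ans, hit p.1 := by
  classical
  induction k generalizing A with
  | zero =>
    have : 0 < A.card := Finset.card_pos.2 ⟨w, hw⟩
    rw [pow_zero, mul_one, ← Nat.cast_one, Nat.cast_lt] at hk
    omega
  | succ k ih =>
    simp only [search, eval_bind, eval, List.mem_append, Option.mem_toList,
      Option.map_eq_some_iff]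
    set g := ((step (center A)).eval ans).2 with hg
    by_cases hcut : g ⬝ᵥ center A ≤ g ⬝ᵥ w
    · obtain ⟨v, hv, hc⟩ := hhit A hcut
      exact ⟨(center A, v), Or.inl ⟨v, hv, rfl⟩, hc⟩
    · obtain ⟨p, hp, hp'⟩ := ih (A.filter fun a => g ⬝ᵥ a < g ⬝ᵥ center A)
        ((Finset.filter_subset _ _).trans hAP)
        (Finset.mem_filter.2 ⟨hw, not_le.1 hcut⟩) (by
          have h1 := hcenter A hAP ⟨w, hw⟩ g
          have h2 := Finset.card_filter_add_card_filter_not (s := A)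
            (fun a => g ⬝ᵥ a < g ⬝ᵥ center A)
          simp only [not_lt] at h2
          have hh' : (0 : ℝ) < h := by exact_mod_cast hh
          have h1' : (A.card : ℝ) / h ≤ (A.filter fun a => g ⬝ᵥ center A ≤ g ⬝ᵥ a).card := by
            rw [div_le_iff₀ hh', mul_comm]; exact_mod_cast h1
          have h2' : ((A.filter fun a => g ⬝ᵥ a < g ⬝ᵥ center A).card : ℝ) +
              (A.filter fun a => g ⬝ᵥ center A ≤ g ⬝ᵥ a).card = A.card := by exact_mod_cast h2
          have h3 : ((A.filter fun a => g ⬝ᵥ a < g ⬝ᵥ center A).card : ℝ) ≤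
              A.card * (1 - 1 / h) := by
            rw [mul_sub, mul_one, mul_one_div]; linarith
          have h4 : (0 : ℝ) ≤ 1 - 1 / h := by
            rw [sub_nonneg, div_le_one hh']; exact_mod_cast hh
          calc _ ≤ (A.card * (1 - 1 / h) : ℝ) * (1 - 1 / h) ^ k := by gcongr
            _ = A.card * (1 - 1 / h) ^ (k + 1) := by ring
            _ < 1 := hk)
      exact ⟨p, Or.inr hp, hp'⟩

end Search

/-- A candidate of least approximate value; `0` if there are no candidates. -/
def bestCandidate {n d : ℕ} (l : List (Vec n d × ℝ)) : Vec n d :=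
  ((l.argmin Prod.snd).map Prod.fst).getD 0

theorem exists_bestCandidate {n d : ℕ} {l : List (Vec n d × ℝ)} {p : Vec n d × ℝ} (hp : p ∈ l) :
    ∃ v, (bestCandidate l, v) ∈ l ∧ v ≤ p.2 := by
  cases h : l.argmin Prod.snd with
  | none => rw [List.argmin_eq_none] at h; simp [h] at hp
  | some q =>
    refine ⟨q.2, ?_, List.le_of_mem_argmin hp h⟩
    simpa [bestCandidate, h] using List.argmin_mem h

/-! ### A grid that contains a deep and almost optimal point -/

/-- The mixed-integer grid of spacing `r` in the continuous coordinates, at distance `r` from the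
boundary of the box. -/
theorem exists_grid (n d : ℕ) {R r : ℝ} (hr : 0 < r) (hr1 : r ≤ 1) (hrR : r ≤ R) :
    ∃ P : Finset (Vec n d), (∀ z ∈ P, z ∈ integerPoints n d ∧ z ∈ box n d (R - r)) ∧
      (P.card : ℝ) ≤ (2 * R / r) ^ (n + d) ∧ (0 : Vec n d) ∈ P ∧
      ∀ w ∈ integerPoints n d, (∀ i, |w (Sum.inl i)| ≤ R - r) → w ∈ box n d (R - 2 * r) →
        ∃ w' ∈ P, SameFiber w' w ∧ w' ∈ supBall w r := by
  classical
  let s : Fin n ⊕ Fin d → ℝ := Sum.elim (fun _ => 1) fun _ => r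
  have hs : ∀ i, r ≤ s i := by rintro (i | j) <;> simp [s, hr1]
  have hs0 : ∀ i, 0 < s i := fun i => hr.trans_le (hs i)
  let m : Fin n ⊕ Fin d → ℤ := fun i => ⌊(R - r) / s i⌋
  have hm : ∀ i (a : ℤ), |s i * a| ≤ R - r ↔ a ∈ Finset.Icc (-m i) (m i) := fun i a => by
    rw [Finset.mem_Icc, ← abs_le, Int.le_floor, abs_mul, abs_of_pos (hs0 i), le_div_iff₀ (hs0 i),
      Int.cast_abs, mul_comm]
  let e : (Fin n ⊕ Fin d → ℤ) → Vec n d := fun a i => s i * a i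
  refine ⟨(Fintype.piFinset fun i => Finset.Icc (-m i) (m i)).image e, ?_, ?_, ?_, ?_⟩
  · intro z hz
    obtain ⟨a, ha, rfl⟩ := Finset.mem_image.1 hz
    exact ⟨fun i => ⟨a (Sum.inl i), by simp [e, s]⟩,
      fun i => (hm i (a i)).2 (Fintype.mem_piFinset.1 ha i)⟩
  · have h1 : ∀ i, ((Finset.Icc (-m i) (m i)).card : ℝ) ≤ 2 * R / r := fun i => by
      have hle : (m i : ℝ) ≤ R / r - 1 := by
        calc (m i : ℝ) ≤ (R - r) / s i := Int.floor_le _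
          _ ≤ (R - r) / r := div_le_div_of_nonneg_left (by linarith) hr (hs i)
          _ = R / r - 1 := by field_simp
      have h0 : 0 ≤ m i := Int.floor_nonneg.2 (div_nonneg (by linarith) (hs0 i).le)
      have h2 : (((Finset.Icc (-m i) (m i)).card : ℤ) : ℝ) = 2 * m i + 1 := by
        rw [Int.card_Icc, Int.toNat_of_nonneg (by omega)]
        push_cast; ring
      rw [Int.cast_natCast] at h2
      rw [h2, mul_div_assoc]
      linarith
    calc (((Fintype.piFinset fun i => Finset.Icc (-m i) (m i)).image e).card : ℝ)
        ≤ ((Fintype.piFinset fun i => Finset.Icc (-m i) (m i)).card : ℝ) := by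
          exact_mod_cast Finset.card_image_le
      _ = ∏ i, ((Finset.Icc (-m i) (m i)).card : ℝ) := by
          rw [Fintype.card_piFinset]; push_cast; rfl
      _ ≤ ∏ _i : Fin n ⊕ Fin d, (2 * R / r) :=
          Finset.prod_le_prod (fun _ _ => Nat.cast_nonneg _) fun i _ => h1 i
      _ = (2 * R / r) ^ (n + d) := by
          rw [Finset.prod_const, Finset.card_univ, Fintype.card_sum, Fintype.card_fin,
            Fintype.card_fin]
  · refine Finset.mem_image.2 ⟨0, Fintype.mem_piFinset.2 fun i => (hm i 0).1 ?_, ?_⟩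
    · simpa using hrR
    · ext i; simp [e]
  · intro w hw hwl hwb
    choose x hx using hw
    let a : Fin n ⊕ Fin d → ℤ := Sum.elim x fun j => round (w (Sum.inr j) / r)
    have hinl : ∀ i, e a (Sum.inl i) = w (Sum.inl i) := fun i => by simp [e, s, a, hx i]
    have hinr : ∀ j, |e a (Sum.inr j) - w (Sum.inr j)| ≤ r / 2 := fun j => by
      have h1 := abs_sub_round (w (Sum.inr j) / r)
      have h2 : e a (Sum.inr j) - w (Sum.inr j) =
          -(r * (w (Sum.inr j) / r - round (w (Sum.inr j) / r))) := by
        simp only [e, s, a, Sum.elim_inr]; field_simp; ring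
      rw [h2, abs_neg, abs_mul, abs_of_pos hr]
      nlinarith
    refine ⟨e a, Finset.mem_image.2 ⟨a, Fintype.mem_piFinset.2 fun i => (hm i _).1 ?_, rfl⟩,
      hinl, ?_⟩
    · rcases i with i | j
      · exact (congrArg abs (hinl i)).trans_le (hwl i)
      · have h1 := hinr j
        have h2 := hwb (Sum.inr j)
        change |e a (Sum.inr j)| ≤ _
        rw [abs_le] at *
        constructor <;> linarith
    · rintro (i | j)
      · simpa [hinl i] using hr.le
      · exact (hinr j).trans (by linarith)

/-- Moving from an optimal solution a little towards the centre of the ball in its fiber gives a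
point that is almost optimal and the centre of a smaller ball in the constraint set. The point can
be taken from the grid. -/
theorem exists_deep_grid_point {n d : ℕ} {R ρ M U ε l r : ℝ} {I : Inst n d}
    (hI : I ∈ deepInstances n d R ρ M U) {P : Finset (Vec n d)} (hr : 0 < r) (hrρ : r ≤ ρ)
    (hl : 0 < l) (hl1 : l ≤ 1) (hlr : 2 * r ≤ l * ρ) (hρR : ρ ≤ R)
    (hlε : 6 * (l * (M * R)) ≤ ε)
    (hP : ∀ w ∈ integerPoints n d, (∀ i, |w (Sum.inl i)| ≤ R - r) → w ∈ box n d (R - 2 * r) →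
        ∃ w' ∈ P, SameFiber w' w ∧ w' ∈ supBall w r) :
    ∃ w ∈ P, supBall w r ⊆ I.C ∧ ∀ w' ∈ I.feasible, I.f w ≤ I.f w' + ε / 2 := by
  classical
  obtain ⟨⟨hCbox, -, hLip⟩, ⟨z, hz⟩, hdeep, -, -⟩ := hI
  obtain ⟨c, hcz, hc⟩ := hdeep z hz
  have hzC : z ∈ I.C := hz.1.1
  set w₀ : Vec n d := (1 - l) • z + l • c with hw₀
  have hw₀C : supBall w₀ (2 * r) ⊆ I.C := fun u hu => by
    have hv : c + l⁻¹ • (u - w₀) ∈ I.C := hc fun i => by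
      simp only [Pi.add_apply, Pi.smul_apply, Pi.sub_apply, smul_eq_mul, add_sub_cancel_left]
      rw [abs_mul, abs_inv, abs_of_pos hl, inv_mul_le_iff₀ hl]
      exact (hu i).trans hlr
    have := I.convex_C hzC hv (sub_nonneg.2 hl1) hl.le (sub_add_cancel 1 l)
    convert this using 1
    rw [smul_add, smul_inv_smul₀ hl.ne', hw₀]
    abel
  -- The ball around a point keeps it away from the boundary of the box.
  have hmargin : ∀ (v : Vec n d) (δ : ℝ), 0 ≤ δ → supBall v δ ⊆ I.C → v ∈ box n d (R - δ) := by
    intro v δ hδ hv i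
    have h1 := hCbox (hv (a := v + fun _ => δ) fun i => by simp [abs_of_nonneg hδ]) i
    have h2 := hCbox (hv (a := v - fun _ => δ) fun i => by simp [abs_of_nonneg hδ]) i
    simp only [Pi.add_apply, Pi.sub_apply] at h1 h2
    rw [abs_le] at *
    constructor <;> linarith
  have hfib : ∀ i : Fin n, w₀ (Sum.inl i) = z (Sum.inl i) := fun i => by
    simp only [hw₀, Pi.add_apply, Pi.smul_apply, smul_eq_mul, hcz i]; ring
  obtain ⟨w, hwP, hwfib, hwball⟩ := hP w₀
    (fun i => by
      obtain ⟨a, ha⟩ := hz.1.2 i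
      exact ⟨a, (hfib i).trans ha⟩)
    (fun i => by
      have := hmargin c ρ (hr.le.trans hrρ) hc (Sum.inl i)
      rw [hfib i, ← hcz i]
      linarith)
    (hmargin w₀ _ (by positivity) hw₀C)
  have hwC : supBall w r ⊆ I.C := fun u hu => hw₀C fun i => by
    have h1 := hu i
    have h2 := hwball i
    rw [abs_le] at *
    constructor <;> linarith
  refine ⟨w, hwP, hwC, fun w' hw' => ?_⟩
  have hwC' : w ∈ I.C := hwC fun i => by simpa using hr.le
  have hcC : c ∈ I.C := hc fun i => by simpa using hr.le.trans hrρ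
  have hdist : w ∈ supBall z (3 * (l * R)) := fun i => by
    have h1 := hwball i
    have h2 : w₀ i - z i = l * (c i - z i) := by
      simp only [hw₀, Pi.add_apply, Pi.smul_apply, smul_eq_mul]; ring
    have h3 : |c i - z i| ≤ 2 * R := by
      have h4 := hCbox hcC i
      have h5 := hCbox hzC i
      rw [abs_le] at *
      constructor <;> linarith
    have h4 : |w₀ i - z i| ≤ l * (2 * R) := by
      rw [h2, abs_mul, abs_of_pos hl]; gcongr
    have h5 : l * ρ ≤ l * R := by gcongr
    have h6 := abs_sub_le (w i) (w₀ i) (z i)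
    linarith
  have hf := hLip z (hCbox hzC) w (hCbox hwC') hz.1.2
    (fun i => (hfib i).symm.trans (hwfib i).symm) _ hdist
  have hopt := hz.2 w' hw'
  rw [abs_le] at hf
  have : M * (3 * (l * R)) = 3 * (l * (M * R)) := by ring
  linarith [hf.1]

/-! ### The number of queries -/

/-- The cutting plane method on a grid reports an approximate solution after
`(h * log N + 1) * S` queries, where `N` bounds the number of points of the grid, `h` is the inverse
depth of mixed-integer centerpoints and `S` is the number of queries in one step. -/
theorem exists_reports {n d : ℕ} {R ρ M U ε l r xs xg xv : ℝ} {H : PermissibleQueries n d}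
    {Φ : Set (ℝ → Bool)} (hΦ : IsReadable Φ)
    (hH : ∀ h ∈ Φ, h ∈ H.val ∧
      ∀ i, (fun g : Vec n d => h (g i)) ∈ H.sep ∧ (fun g : Vec n d => h (g i)) ∈ H.sub)
    (hd : 1 ≤ d) (hr : 0 < r) (hr1 : r ≤ 1) (hrρ : r ≤ ρ) (hρR : ρ ≤ R) (hε : 0 < ε)
    (hl : 0 < l) (hl1 : l ≤ 1) (hlr : 2 * r ≤ l * ρ)
    (hlε : 6 * (l * (M * R)) ≤ ε)
    (hxs : 1 ≤ xs) (hxs' : 1 ≤ xs * (r / (4 * (n + d) * R)))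
    (hxg : 1 ≤ xg) (hxg' : 2 * M * R / r ≤ xg * (ε / (8 * (n + d) * R)))
    (hxv : 1 ≤ xv) (hxv' : U ≤ xv * (ε / 16)) :
    ∃ (D : Strategy R H) (out : List (Query R H × Bool) → Vec n d) (k : ℕ),
      (k : ℝ) ≤ (2 ^ n * (d + 1) * ((n + d) * Real.log (2 * R / r)) + 1) *
        ((n + d) * (2 * Real.log xs + 4) +
          ((n + d) * (2 * Real.log xg + 4) + (2 * Real.log xv + 4))) ∧
      Reports (deepInstances n d R ρ M U) ε D out k := by
  classical
  have hrR : r ≤ R := hrρ.trans hρR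
  have hlogs := Real.log_nonneg hxs
  have hlogg := Real.log_nonneg hxg
  have hlogv := Real.log_nonneg hxv
  obtain ⟨P, hPZ, hPcard, hP0, hP⟩ := exists_grid n d hr hr1 hrR
  obtain ⟨step, hdepth, hstep⟩ := exists_cutting_step (ρ := ρ) (U := U) hΦ hH hd hr hrR hε
    hxs hxs' hxg hxg' hxv hxv'
  set S : ℝ := (n + d) * (2 * Real.log xs + 4) +
    ((n + d) * (2 * Real.log xg + 4) + (2 * Real.log xv + 4)) with hS
  have hS0 : 0 ≤ S := by positivity
  set h : ℕ := 2 ^ n * (d + 1) with hh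
  have hh0 : 0 < h := by positivity
  have hboxconv : Convex ℝ (box n d (R - r)) := by
    have : box n d (R - r) = Set.pi Set.univ fun _ => Set.Icc (-(R - r)) (R - r) := by
      ext z; simp only [box, Set.mem_ofPred_eq, Set.mem_pi, Set.mem_univ, true_imp_iff, Set.mem_Icc,
        abs_le]
    rw [this]
    exact convex_pi fun _ _ => convex_Icc _ _
  -- Centerpoints of the subsets of the grid; the value at other sets does not matter.
  have hcenter : ∀ A : Finset (Vec n d), ∃ z, (z ∈ integerPoints n d ∧ z ∈ box n d (R - r)) ∧
      (A ⊆ P → A.Nonempty → ∀ g : Vec n d,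
        A.card ≤ h * (A.filter fun a => g ⬝ᵥ z ≤ g ⬝ᵥ a).card) := fun A => by
    by_cases hA : A ⊆ P ∧ A.Nonempty
    · obtain ⟨z, hz1, hz2, hz3⟩ := exists_centerpoint A hA.2 fun a ha => (hPZ a (hA.1 ha)).1
      exact ⟨z, ⟨hz1, convexHull_min (fun a ha => (hPZ a (hA.1 ha)).2) hboxconv hz2⟩,
        fun _ _ => hz3⟩
    · exact ⟨0, hPZ 0 hP0, fun h1 h2 => absurd ⟨h1, h2⟩ hA⟩
  choose center hcZ hcut using hcenter
  set k : ℕ := ⌊h * Real.log P.card⌋₊ + 1 with hk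
  have hPpos : (1 : ℝ) ≤ P.card := by exact_mod_cast Finset.card_pos.2 ⟨0, hP0⟩
  have hlogP := Real.log_nonneg hPpos
  have hklt : (P.card : ℝ) * (1 - 1 / h) ^ k < 1 := by
    have hh0' : (0 : ℝ) < h := by exact_mod_cast hh0
    have h1 : (1 - 1 / h : ℝ) ^ k ≤ Real.exp (-(k / h)) := by
      have h2 := Real.one_sub_le_exp_neg (1 / h : ℝ)
      have h3 : (0 : ℝ) ≤ 1 - 1 / h := by
        rw [sub_nonneg, div_le_one hh0']; exact_mod_cast hh0
      calc (1 - 1 / h : ℝ) ^ k ≤ Real.exp (-(1 / h)) ^ k := pow_le_pow_left₀ h3 h2 k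
        _ = Real.exp (-(k / h)) := by rw [← Real.exp_nat_mul]; congr 1; ring
    have h4 : Real.log P.card < k / h := by
      rw [lt_div_iff₀ hh0', mul_comm, hk]
      push_cast
      exact Nat.lt_floor_add_one _
    calc (P.card : ℝ) * (1 - 1 / h) ^ k ≤ P.card * Real.exp (-(k / h)) := by gcongr
      _ < P.card * Real.exp (-Real.log P.card) := by gcongr
      _ = 1 := by
        rw [Real.exp_neg, Real.exp_log (by linarith), mul_inv_cancel₀ (by linarith)]
  let t : DecisionTree (Query R H) (Vec n d) :=
    (search step center k P).bind fun l => leaf (bestCandidate l)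
  obtain ⟨φ, hφ⟩ : Φ.Nonempty := by
    -- A readable class is nonempty since the numbers `0` and `1` can be told apart.
    by_contra hempty
    rw [Set.not_nonempty_iff_eq_empty] at hempty
    obtain ⟨t, -, ht⟩ := hΦ Unit (fun _ => ()) 1 (1 / 4) 4 (by norm_num) (by norm_num)
      (by norm_num)
    have h0 := ht (fun _ => true) 0 (fun h => by have := h.2; simp [hempty] at this) (by simp)
    have h1 := ht (fun _ => true) 1 (fun h => by have := h.2; simp [hempty] at this) (by simp)
    rw [abs_le] at h0 h1
    linarith [h0.1, h0.2, h1.1, h1.2]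
  have h0R : (0 : Vec n d) ∈ box n d R := fun i => by simpa using hr.le.trans hrR
  obtain ⟨D, out, hrep⟩ := exists_strategy_of_decisionTree
    (𝓘 := deepInstances n d R ρ M U) (ε := ε)
    (Query.val (H := H) (⟨0, h0R⟩ : box n d R) ⟨φ, (hH φ hφ).1⟩) t (fun G I hI => by
      obtain ⟨w, hwP, hwC, hwopt⟩ := exists_deep_grid_point hI hr hrρ hl hl1 hlr hρR hlε hP
      have hspec := fun A => hstep G I hI (center A) (hcZ A).2 (hcZ A).1 w hwC
      obtain ⟨p, hp, hpf⟩ := exists_mem_search (step := step) (center := center)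
        (ans := fun q => q.answer G I) (hit := fun z => I.f z ≤ I.f w + ε / 4) hh0 hcut
        (fun A => (hspec A).2) k P subset_rfl hwP hklt
      have hgood := forall_mem_search (step := step) (center := center)
        (ans := fun q => q.answer G I)
        (good := fun z v => z ∈ I.feasible ∧ |v - I.f z| ≤ ε / 16) (fun A => (hspec A).1) k P
      obtain ⟨v, hv, hvp⟩ := exists_bestCandidate hp
      have h1 := hgood _ hv
      have h2 := hgood _ hp
      simp only [t, eval_bind, eval]
      refine ⟨h1.1, fun w' hw' => ?_⟩
      have h3 := hwopt w' hw'
      have h4 := h1.2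
      have h5 := h2.2
      rw [abs_le] at h4 h5
      linarith [h4.1, h5.2])
  refine ⟨D, out, t.depth, ?_, hrep⟩
  have h1 : t.depth ≤ k * ⌊S⌋₊ :=
    (depth_bind_le (k := 0) (fun l => le_rfl) _).trans
      (depth_search_le (fun z => Nat.le_floor (hdepth z)) k P)
  have h2 : (t.depth : ℝ) ≤ k * ⌊S⌋₊ := by exact_mod_cast h1
  have h3 : (k : ℝ) ≤ h * Real.log P.card + 1 := by
    rw [hk]; push_cast
    linarith [Nat.floor_le (show 0 ≤ (h : ℝ) * Real.log P.card by positivity)]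
  have h4 : Real.log P.card ≤ (n + d) * Real.log (2 * R / r) := by
    have := Real.log_le_log (by linarith) hPcard
    rw [Real.log_pow] at this
    push_cast at this
    exact this
  have h5 : (h : ℝ) * Real.log P.card + 1 ≤
      2 ^ n * (d + 1) * ((n + d) * Real.log (2 * R / r)) + 1 := by
    have : (h : ℝ) = 2 ^ n * (d + 1) := by rw [hh]; push_cast; ring
    rw [this]
    gcongr
  calc (t.depth : ℝ) ≤ k * ⌊S⌋₊ := h2
    _ ≤ (2 ^ n * (d + 1) * ((n + d) * Real.log (2 * R / r)) + 1) * S :=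
      mul_le_mul (h3.trans h5) (Nat.floor_le hS0) (Nat.cast_nonneg _)
        (k.cast_nonneg.trans (h3.trans h5))

/-- The number of queries of the cutting plane method in terms of `T = M * R / (min ρ 1 * ε)`,
`m = n + d` and `u = U / ε`; here `g` is the logarithm of the number of grid points on a line. -/
theorem query_count_le (n : ℕ) {d m T u g : ℝ} (hd : 1 ≤ d) (hm : 1 ≤ m) (hT : 2 ≤ T)
    (hu : 1 ≤ u) (hg0 : 0 ≤ g) (hg : g ≤ 7 * Real.log T) :
    (2 ^ n * (d + 1) * (m * g) + 1) * (m * (2 * Real.log (48 * m * T ^ 2) + 4) +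
      (m * (2 * Real.log (192 * m * T ^ 3) + 4) + (2 * Real.log (16 * u) + 4))) ≤
    1168 * (2 ^ n * d * m * Real.log T) * (m * Real.log (m * T) + Real.log u) := by
  have hT0 : 0 < T := by linarith
  have hmT : 2 ≤ m * T := by nlinarith
  have hlog2 := Real.log_two_gt_d9
  have hlogT : Real.log 2 ≤ Real.log T := Real.log_le_log (by norm_num) hT
  have hlogmT : Real.log T ≤ Real.log (m * T) := Real.log_le_log hT0 (by nlinarith)
  have hlogU : 0 ≤ Real.log u := Real.log_nonneg hu
  set ℓ := Real.log (m * T) with hℓ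
  set V := Real.log u with hV
  have hmm : m ≤ m ^ 2 := by nlinarith
  have hxs : Real.log (48 * m * T ^ 2) ≤ 8 * ℓ := by
    have h3 : (2 : ℝ) ^ 6 ≤ (m * T) ^ 6 := by gcongr
    have h1 : 48 * m * T ^ 2 ≤ (m * T) ^ 8 := by
      calc 48 * m * T ^ 2 ≤ (m * T) ^ 6 * m ^ 2 * T ^ 2 := by gcongr; linarith
        _ = (m * T) ^ 8 := by ring
    have h4 := Real.log_le_log (by positivity) h1
    rw [Real.log_pow] at h4
    exact_mod_cast h4
  have hxg : Real.log (192 * m * T ^ 3) ≤ 11 * ℓ := by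
    have h3 : (2 : ℝ) ^ 8 ≤ (m * T) ^ 8 := by gcongr
    have hm3 : m ≤ m ^ 3 := le_self_pow₀ hm (by norm_num)
    have h1 : 192 * m * T ^ 3 ≤ (m * T) ^ 11 := by
      calc 192 * m * T ^ 3 ≤ (m * T) ^ 8 * m ^ 3 * T ^ 3 := by gcongr; linarith
        _ = (m * T) ^ 11 := by ring
    have h4 := Real.log_le_log (by positivity) h1
    rw [Real.log_pow] at h4
    exact_mod_cast h4
  have hxv : Real.log (16 * u) ≤ 4 * ℓ + V := by
    rw [Real.log_mul (by norm_num) (by positivity), show (16 : ℝ) = 2 ^ 4 by norm_num,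
      Real.log_pow]
    push_cast
    linarith
  have hℓm : ℓ ≤ m * ℓ := le_mul_of_one_le_left (by linarith) hm
  have hS : m * (2 * Real.log (48 * m * T ^ 2) + 4) +
      (m * (2 * Real.log (192 * m * T ^ 3) + 4) + (2 * Real.log (16 * u) + 4)) ≤
      73 * (m * ℓ + V) := by
    have h1 : m * (2 * Real.log (48 * m * T ^ 2) + 4) ≤ m * (22 * ℓ) := by gcongr; linarith
    have h2 : m * (2 * Real.log (192 * m * T ^ 3) + 4) ≤ m * (28 * ℓ) := by gcongr; linarith
    linarith
  have hiter : 2 ^ n * (d + 1) * (m * g) + 1 ≤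
      16 * (2 ^ n * d * m * Real.log T) := by
    have h2n : (1 : ℝ) ≤ 2 ^ n := one_le_pow₀ (by norm_num)
    have h1 : 2 ^ n * (d + 1) * (m * g) ≤
        2 ^ n * (2 * d) * (m * (7 * Real.log T)) := by gcongr; linarith
    have h2 : (1 : ℝ) ≤ 2 ^ n * d * m := by
      have := one_le_mul_of_one_le_of_one_le h2n hd
      exact one_le_mul_of_one_le_of_one_le this hm
    have h3 : Real.log T ≤ 2 ^ n * d * m * Real.log T :=
      le_mul_of_one_le_left (by linarith) h2
    linarith
  have hlogT0 : 0 ≤ Real.log T := by linarith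
  have hSpos : 0 ≤ 73 * (m * ℓ + V) := by
    have : 0 ≤ m * ℓ := by nlinarith
    linarith
  calc _ ≤ (2 ^ n * (d + 1) * (m * g) + 1) * (73 * (m * ℓ + V)) := by
        exact mul_le_mul_of_nonneg_left hS (by positivity)
    _ ≤ 16 * (2 ^ n * d * m * Real.log T) * (73 * (m * ℓ + V)) := by gcongr
    _ = 1168 * (2 ^ n * d * m * Real.log T) * (m * ℓ + V) := by ring

end MixedInteger

theorem theorem10 :
    ∃ K : ℝ, 0 < K ∧
      ∀ (n d : ℕ) (R ρ M U ε : ℝ), 1 ≤ d → 0 < ρ → ρ ≤ R → 0 < ε →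
        ε ≤ M → ε ≤ U → 2 * (min ρ 1 * ε) ≤ M * R →
      ∀ H : MixedInteger.PermissibleQueries n d,
        (H = MixedInteger.bitQueries n d ∨ H = MixedInteger.dirQueries n d) →
      ∃ (D : MixedInteger.Strategy R H)
        (out : List (MixedInteger.Query R H × Bool) → MixedInteger.Vec n d) (k : ℕ),
        (k : ℝ) ≤
          K * (2 ^ n * d * (n + d) * Real.log (M * R / (min ρ 1 * ε))) *
            ((n + d) * Real.log ((n + d) * M * R / (min ρ 1 * ε)) + Real.log (U / ε)) ∧
        MixedInteger.Reports (MixedInteger.deepInstances n d R ρ M U) ε D out k := by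
  refine ⟨1168, by norm_num, fun n d R ρ M U ε hd hρ hρR hε hεM hεU hMR H hH => ?_⟩
  obtain ⟨Φ, hΦ, hΦH⟩ := MixedInteger.exists_isReadable hH
  have hR : 0 < R := hρ.trans_le hρR
  have hM : 0 < M := hε.trans_le hεM
  have hd' : (1 : ℝ) ≤ d := by exact_mod_cast hd
  set m : ℝ := n + d with hm
  have hm1 : 1 ≤ m := by have : (0 : ℝ) ≤ n := n.cast_nonneg; linarith
  set ρ₀ : ℝ := min ρ 1 with hρ₀
  have hρ₀0 : 0 < ρ₀ := lt_min hρ one_pos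
  have hρ₀ρ : ρ₀ ≤ ρ := min_le_left _ _
  have hρ₀1 : ρ₀ ≤ 1 := min_le_right _ _
  set T : ℝ := M * R / (ρ₀ * ε) with hT
  have hMRT : M * R = T * (ρ₀ * ε) := by rw [hT]; field_simp
  have hT2 : 2 ≤ T := by rw [hT, le_div_iff₀ (by positivity)]; exact hMR
  have hT0 : 0 < T := by linarith
  have hRT : R ≤ ρ₀ * T := by
    have h1 : ε * R ≤ M * R := by gcongr
    rw [hMRT] at h1
    nlinarith
  have hRT' : R ≤ T := hRT.trans (by nlinarith)
  -- The radius of the deep balls: moving by the fraction `1 / (6 * T)` from an optimal solution to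
  -- the centre of its ball leaves a ball of radius `2 * r`, and rounding to the grid costs `r`.
  set r : ℝ := ρ₀ / (12 * T) with hr
  have hr0 : 0 < r := by positivity
  have hrρ₀ : r ≤ ρ₀ := div_le_self hρ₀0.le (by linarith)
  have hUε : 1 ≤ U / ε := by rwa [one_le_div hε]
  -- `xs`, `xg` and `xv` bound the ratio of range and accuracy in the readings of the coordinates of
  -- separating hyperplanes, of the coordinates of subgradients, and of values.
  obtain ⟨D, out, k, hk, hrep⟩ := MixedInteger.exists_reports (n := n) (d := d) (R := R)
    (ρ := ρ) (M := M) (U := U) (ε := ε) (l := 1 / (6 * T)) (r := r) (xs := 48 * m * T ^ 2)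
    (xg := 192 * m * T ^ 3) (xv := 16 * (U / ε)) hΦ hΦH hd hr0 (hrρ₀.trans hρ₀1)
    (hrρ₀.trans hρ₀ρ) hρR hε (by positivity)
    (by rw [div_le_one (by positivity)]; linarith)
    (by
      rw [hr]
      calc 2 * (ρ₀ / (12 * T)) = 1 / (6 * T) * ρ₀ := by field_simp; norm_num
        _ ≤ 1 / (6 * T) * ρ := by gcongr)
    (by
      rw [hMRT]
      calc 6 * (1 / (6 * T) * (T * (ρ₀ * ε))) = ρ₀ * ε := by field_simp
        _ ≤ ε := by nlinarith)
    (by nlinarith [one_le_pow₀ (n := 2) (show 1 ≤ T by linarith)])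
    (by
      rw [← hm, hr]
      calc (1 : ℝ) ≤ ρ₀ * T / R := by rwa [one_le_div hR]
        _ = 48 * m * T ^ 2 * (ρ₀ / (12 * T) / (4 * m * R)) := by field_simp; norm_num)
    (by nlinarith [one_le_pow₀ (n := 3) (show 1 ≤ T by linarith)])
    (by
      rw [← hm, hr, mul_assoc 2 M R, hMRT]
      calc 2 * (T * (ρ₀ * ε)) / (ρ₀ / (12 * T)) = 24 * T ^ 2 * ε := by field_simp; norm_num
        _ ≤ 24 * T ^ 2 * ε * (T / R) := by
          refine le_mul_of_one_le_right (by positivity) ?_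
          rwa [one_le_div hR]
        _ = 192 * m * T ^ 3 * (ε / (8 * m * R)) := by field_simp; norm_num)
    (by linarith)
    (by apply le_of_eq; field_simp)
  refine ⟨D, out, k, hk.trans ?_, hrep⟩
  have hgrid : Real.log (2 * R / r) ≤ 7 * Real.log T := by
    have h1 : 2 * R / r ≤ T ^ 7 := by
      have h2 : 2 * R / r ≤ 24 * T ^ 2 := by
        rw [hr, div_le_iff₀ (by positivity)]
        calc 2 * R ≤ 2 * (ρ₀ * T) := by linarith
          _ = 24 * T ^ 2 * (ρ₀ / (12 * T)) := by field_simp; norm_num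
      have h3 : (2 : ℝ) ^ 5 ≤ T ^ 5 := by gcongr
      calc 2 * R / r ≤ 24 * T ^ 2 := h2
        _ ≤ T ^ 5 * T ^ 2 := by gcongr; linarith
        _ = T ^ 7 := by ring
    have h4 := Real.log_le_log (by positivity) h1
    rw [Real.log_pow] at h4
    exact_mod_cast h4
  have hgrid0 : 0 ≤ Real.log (2 * R / r) := Real.log_nonneg (by
    rw [le_div_iff₀ hr0]; linarith [hrρ₀, hρ₀ρ])
  rw [← hm, show m * M * R / (ρ₀ * ε) = m * T by rw [hT]; ring]
  exact MixedInteger.query_count_le n hd' hm1 hT2 hUε hgrid0 hgrid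

end
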